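/- **Setting.** There are $M$ flows and a finite set $\mathcal A$ of actions; action $\alpha$ has an integer frame size $T(\alpha)\ge 1$ and a clearance vector $\mu(\alpha)\in\mathbb Z_{\ge0}^M$. Arrival vectors $A(t)\in\{0,1\}^M$ are i.i.d. over slots $t=0,1,2,\dots$ with mean $\lambda=(\lambda_1,\dots,\lambda_M)$ (components of one vector may be dependent). Frame $0$ starts at $t[0]=0$, and $t[r+1]=t[r]+T(\alpha[r])$, where $\alpha[r]\in\mathcal A$ is the action of frame $r$. It is chosen causally: there is a filtration $(\mathcal F_t)$ such that $A(s)$ is $\mathcal F_{s+1}$-measurable, $A(t)$ is independent of $\mathcal F_t$, and $\{t[r]=t,\ \alpha[r]=a\}\in\mathcal F_t$ for all $r,t,a$. Queues start empty, $Q_m[0]=0$, and $$Q_m[r+1]=\max(Q_m[r]-\mu_m(\alpha[r]),0)+a_m[r],\qquad a_m[r]=\sum_{\tau=t[r]}^{t[r]+T(\alpha[r])-1}A_m(\tau).$$ The code-constrained capacity region $\Lambda_{\mathcal A}$ is the set of mean vectors of i.i.d. (over slots) non-negative integer arrival vectors for which some causal choice of actions gives $Q_m[R]/R\to0$ almost surely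 for all $m$. *Algorithm 1* always chooses $\alpha[r]$ as a maximizer over $\alpha\in\mathcal A$ of $\sum_m Q_m[r](\mu_m(\alpha)-\lambda_mT(\alpha))$; *Algorithm 2* always chooses a maximizer of $\sum_m Q_m[r]\mu_m(\alpha)/T(\alpha)$. Ties are broken arbitrarily, but causally. Put $Y[r]=\tfrac12\sum_m(a_m[r]^2+\mu_m(\alpha[r])^2)$, and let $\mathcal H_r$ be the $\sigma$-algebra generated by the actions and the arrival counts $a[s]$ of the frames $s<r$. **Theorem.** (1) Let $0\le\rho<1$ and $\lambda\in\rho\Lambda_{\mathcal A}$, and let $B$ be a constant with $\mathbb E[Y[r]\mid Q[r]]\le B$ a.s. for all $r$. Under each of the two algorithms all $Q_m[r]$ are integrable and $$\frac1R\sum_{r=0}^{R-1}\sum_{m=1}^M\lambda_m\mathbb E[Q_m[r]]\le\frac{B\rho}{1-\rho}\quad\text{for all } R\ge1 .$$ If moreover $\mathbb P(\alpha[r]=a\mid\mathcal H_r)=\mathbb P(\alpha[r]=a\mid Q[r])$ a.s. for all $r,a$ (tie-breaking looks at the past only through $Q[r]$), then almost surely $$\limsup_{R\to\infty}\frac1R\sum_{r=0}^{R-1}\sum_{m=1}^M\lambda_mQ_m[r]\le\frac{B\rho}{1-\rho}.$$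 For arbitrary causal tie-breaking the almost sure bound holds for each constant $B$ with $\mathbb E[Y[r]\mid\mathcal H_r]\le B$ a.s. for all $r$. (2) In (1) there is a probability vector $p$ on $\mathcal A$ with $$\lambda_m\le\rho\,\frac{\sum_\alpha p(\alpha)\mu_m(\alpha)}{\sum_\alpha p(\alpha)T(\alpha)}\quad\text{for all } m,$$ and for every such $p$, with $T^*=\sum_\alpha p(\alpha)T(\alpha)$, all bounds in (1) hold under Algorithm 1 with $\frac{B\rho}{T^*(1-\rho)}$ in place of $\frac{B\rho}{1-\rho}$. (3) There is a constant $B$ depending only on the action set (on $\mathcal A$, $T$, $\mu$) that satisfies both conditions on $B$ in (1) for every arrival process as above and every causal choice of actions. (4) The average queue size is $O(1/(1-\rho))$: for every $\lambda^0\in\Lambda_{\mathcal A}$ there is a constant $C$ such that for all $0\le\rho<1$ and all systems as above with $\lambda=\rho\lambda^0$ run by either algorithm, $$\frac1R\sum_{r=0}^{R-1}\sum_{m=1}^M\mathbb E[Q_m[r]]\le\frac{C}{1-\rho}\quad\text{for all } R\ge1,$$ and almost surely $$\limsup_{R\to\infty}\frac1R\sum_{r=0}^{R-1}\sum_{m=1}^MQ_m[r]\le\frac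 C{1-\rho}.$$ -/

import Mathlib

open MeasureTheory ProbabilityTheory Filter Topology
open scoped Pointwise

namespace IndexCoding

noncomputable section

/-! ### Sample-path dynamics

`T a` is the frame size of action `a`, `μ a m` the number of packets of flow `m` cleared by it,
`α r` the action used on frame `r`, `A t m` the number of packets of flow `m` arriving on slot `t`. -/

/-- The slot `t[r]` that starts frame `r`. -/
def frameStart {𝒜 : Type*} (T : 𝒜 → ℕ) (α : ℕ → 𝒜) : ℕ → ℕ
  | 0 => 0
  | r + 1 => frameStart T α r + T (α r)

/-- The number of arrivals of flow `m` during frame `r`. -/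
def frameArrivals {M : ℕ} {𝒜 : Type*} (T : 𝒜 → ℕ) (α : ℕ → 𝒜) (A : ℕ → Fin M → ℕ)
    (r : ℕ) (m : Fin M) : ℕ :=
  ∑ τ ∈ Finset.Ico (frameStart T α r) (frameStart T α r + T (α r)), A τ m

/-- The backlog `Q_m[r]` at the beginning of frame `r`, started empty.
The subtraction is the truncated one of `ℕ`, i.e. `max (Q - μ) 0`. -/
def backlog {M : ℕ} {𝒜 : Type*} (T : 𝒜 → ℕ) (μ : 𝒜 → Fin M → ℕ) (α : ℕ → 𝒜)
    (A : ℕ → Fin M → ℕ) : ℕ → Fin M → ℕ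
  | 0 => fun _ => 0
  | r + 1 => fun m => (backlog T μ α A r m - μ (α r) m) + frameArrivals T α A r m

/-! ### Random arrivals and causal action sequences -/

/-- Arrival vectors that are i.i.d. over slots with mean `lam`
(the components of one vector may be dependent). -/
structure IIDArrivals {M : ℕ} {Ω : Type*} [MeasurableSpace Ω] (P : Measure Ω)
    (A : ℕ → Ω → Fin M → ℕ) (lam : Fin M → ℝ) : Prop where
  measurable : ∀ t, Measurable (A t)
  indep : iIndepFun A P
  identDistrib : ∀ t, IdentDistrib (A t) (A 0) P P
  integrable : ∀ t m, Integrable (fun ω => (A t ω m : ℝ)) P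
  mean : ∀ t m, ∫ ω, (A t ω m : ℝ) ∂P = lam m

/-- A (possibly randomized, possibly history-dependent) selection of actions is causal if there is
an information flow `ℱ`, where `ℱ t` is what is known at the beginning of slot `t`, such that
arrivals before slot `t` are known, the arrivals on slot `t` are independent of `ℱ t`, and the
action of a frame is decided with the information available when the frame starts. -/
def IsCausal {M : ℕ} {𝒜 : Type*} {Ω : Type*} [mΩ : MeasurableSpace Ω] (P : Measure Ω)
    (T : 𝒜 → ℕ) (A : ℕ → Ω → Fin M → ℕ) (α : ℕ → Ω → 𝒜) : Prop :=
  ∃ ℱ : Filtration ℕ mΩ,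
    (∀ t, Measurable[ℱ (t + 1)] (A t)) ∧
    (∀ t, Indep (ℱ t) (MeasurableSpace.comap (A t) inferInstance) P) ∧
    (∀ r t a, MeasurableSet[ℱ t]
      {ω | frameStart T (fun s => α s ω) r = t ∧ α r ω = a})

/-- The random backlog vector at the beginning of frame `r`. -/
def queue {M : ℕ} {𝒜 : Type*} {Ω : Type*} (T : 𝒜 → ℕ) (μ : 𝒜 → Fin M → ℕ)
    (A : ℕ → Ω → Fin M → ℕ) (α : ℕ → Ω → 𝒜) (r : ℕ) (ω : Ω) : Fin M → ℕ :=
  backlog T μ (fun s => α s ω) (fun t => A t ω) r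

/-- The random arrival counts of frame `r`. -/
def arrivals {M : ℕ} {𝒜 : Type*} {Ω : Type*} (T : 𝒜 → ℕ)
    (A : ℕ → Ω → Fin M → ℕ) (α : ℕ → Ω → 𝒜) (r : ℕ) (ω : Ω) : Fin M → ℕ :=
  frameArrivals T (fun s => α s ω) (fun t => A t ω) r

/-- All queues are rate stable: `Q_m[R] / R → 0` with probability one. -/
def RateStable {M : ℕ} {𝒜 : Type*} {Ω : Type*} [MeasurableSpace Ω] (P : Measure Ω)
    (T : 𝒜 → ℕ) (μ : 𝒜 → Fin M → ℕ) (A : ℕ → Ω → Fin M → ℕ) (α : ℕ → Ω → 𝒜) : Prop :=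
  ∀ m, ∀ᵐ ω ∂P, Tendsto (fun R : ℕ => (queue T μ A α R ω m : ℝ) / R) atTop (𝓝 0)

/-- The code-constrained capacity region: the rate vectors of i.i.d. arrivals for which some
algorithm for selecting the actions makes all queues rate stable. -/
def capacityRegion {M : ℕ} {𝒜 : Type*} (T : 𝒜 → ℕ) (μ : 𝒜 → Fin M → ℕ) : Set (Fin M → ℝ) :=
  {lam | ∃ (Ω : Type) (_ : MeasurableSpace Ω) (P : Measure Ω) (_ : IsProbabilityMeasure P)
      (A : ℕ → Ω → Fin M → ℕ) (α : ℕ → Ω → 𝒜),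
      IIDArrivals P A lam ∧ IsCausal P T A α ∧ RateStable P T μ A α}

/-- Arrivals and actions of the dynamic system under a causal algorithm: at most one packet per
flow and slot, i.i.d. over slots with rates `lam`. -/
structure IsSystem {M : ℕ} {𝒜 : Type*} {Ω : Type*} [MeasurableSpace Ω] (P : Measure Ω)
    (T : 𝒜 → ℕ) (lam : Fin M → ℝ) (A : ℕ → Ω → Fin M → ℕ) (α : ℕ → Ω → 𝒜) : Prop where
  arrivals_iid : IIDArrivals P A lam
  arrivals_le_one : ∀ t ω m, A t ω m ≤ 1
  causal : IsCausal P T A α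

/-! ### The two max-weight algorithms -/

/-- Algorithm 1 (known rates): on every frame the action maximizes
`∑ m, Q_m[r] (μ_m(a) - λ_m T(a))`, ties being broken arbitrarily. -/
def IsMaxWeight1 {M : ℕ} {𝒜 : Type*} {Ω : Type*} (T : 𝒜 → ℕ) (μ : 𝒜 → Fin M → ℕ)
    (lam : Fin M → ℝ) (A : ℕ → Ω → Fin M → ℕ) (α : ℕ → Ω → 𝒜) : Prop :=
  ∀ r ω, IsMaxOn (fun a : 𝒜 => ∑ m, (queue T μ A α r ω m : ℝ) * ((μ a m : ℝ) - lam m * T a))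
    Set.univ (α r ω)

/-- Algorithm 2 (unknown rates): on every frame the action maximizes
`∑ m, Q_m[r] (μ_m(a) / T(a))`, ties being broken arbitrarily. -/
def IsMaxWeight2 {M : ℕ} {𝒜 : Type*} {Ω : Type*} (T : 𝒜 → ℕ) (μ : 𝒜 → Fin M → ℕ)
    (A : ℕ → Ω → Fin M → ℕ) (α : ℕ → Ω → 𝒜) : Prop :=
  ∀ r ω, IsMaxOn (fun a : 𝒜 => ∑ m, (queue T μ A α r ω m : ℝ) * ((μ a m : ℝ) / T a))
    Set.univ (α r ω)

/-! ### The constant `B` -/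

/-- `(1/2) ∑ m, (arrivals_m[r] ^ 2 + μ_m(α[r]) ^ 2)`. -/
def halfSquares {M : ℕ} {𝒜 : Type*} {Ω : Type*} (T : 𝒜 → ℕ) (μ : 𝒜 → Fin M → ℕ)
    (A : ℕ → Ω → Fin M → ℕ) (α : ℕ → Ω → 𝒜) (r : ℕ) (ω : Ω) : ℝ :=
  (1 / 2) * ∑ m, ((arrivals T A α r ω m : ℝ) ^ 2 + (μ (α r ω) m : ℝ) ^ 2)

/-- The σ-algebra generated by the backlog vector `Q[r]`. -/
abbrev backlogInfo {M : ℕ} {𝒜 : Type*} {Ω : Type*} (T : 𝒜 → ℕ) (μ : 𝒜 → Fin M → ℕ)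
    (A : ℕ → Ω → Fin M → ℕ) (α : ℕ → Ω → 𝒜) (r : ℕ) : MeasurableSpace Ω :=
  MeasurableSpace.comap (queue T μ A α r) inferInstance

/-- The σ-algebra generated by the actions and the arrival counts of the frames before `r`. -/
abbrev historyInfo {M : ℕ} {𝒜 : Type*} {Ω : Type*} (T : 𝒜 → ℕ)
    (A : ℕ → Ω → Fin M → ℕ) (α : ℕ → Ω → 𝒜) (r : ℕ) : MeasurableSpace Ω :=
  ⨆ s : ℕ, ⨆ _ : s < r, MeasurableSpace.comap (α s) ⊤ ⊔
    MeasurableSpace.comap (arrivals T A α s) inferInstance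

/-- `B ≥ E[(1/2) ∑ m, (arrivals_m[r]^2 + μ_m(α[r])^2) | Q[r]]` for every frame `r`. -/
def BoundGivenBacklog {M : ℕ} {𝒜 : Type*} {Ω : Type*} [MeasurableSpace Ω] (P : Measure Ω)
    (T : 𝒜 → ℕ) (μ : 𝒜 → Fin M → ℕ) (A : ℕ → Ω → Fin M → ℕ) (α : ℕ → Ω → 𝒜) (B : ℝ) : Prop :=
  ∀ r, ∀ᵐ ω ∂P, (P[halfSquares T μ A α r | backlogInfo T μ A α r]) ω ≤ B

/-- The same with the conditional expectation given all past frames. -/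
def BoundGivenHistory {M : ℕ} {𝒜 : Type*} {Ω : Type*} [MeasurableSpace Ω] (P : Measure Ω)
    (T : 𝒜 → ℕ) (μ : 𝒜 → Fin M → ℕ) (A : ℕ → Ω → Fin M → ℕ) (α : ℕ → Ω → 𝒜) (B : ℝ) : Prop :=
  ∀ r, ∀ᵐ ω ∂P, (P[halfSquares T μ A α r | historyInfo T A α r]) ω ≤ B

/-- Given the past frames, the conditional law of the action `α[r]` depends on `Q[r]` only (as
when ties are broken by a rule, or a fresh coin, that looks at `Q[r]` only). -/
def IsBacklogBased {M : ℕ} {𝒜 : Type*} {Ω : Type*} [MeasurableSpace Ω] (P : Measure Ω)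
    (T : 𝒜 → ℕ) (μ : 𝒜 → Fin M → ℕ) (A : ℕ → Ω → Fin M → ℕ) (α : ℕ → Ω → 𝒜) : Prop :=
  ∀ r a, P[({ω | α r ω = a}).indicator (fun _ => (1 : ℝ)) | historyInfo T A α r] =ᵐ[P]
    P[({ω | α r ω = a}).indicator (fun _ => (1 : ℝ)) | backlogInfo T μ A α r]

/-- Probabilities `p` over the actions with
`λ_m ≤ ρ (∑ a, p(a) μ_m(a)) / (∑ a, p(a) T(a))` for all `m`. -/
def IsStationaryPolicy {M : ℕ} {𝒜 : Type*} [Fintype 𝒜] (T : 𝒜 → ℕ) (μ : 𝒜 → Fin M → ℕ)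
    (lam : Fin M → ℝ) (ρ : ℝ) (p : 𝒜 → ℝ) : Prop :=
  (∀ a, 0 ≤ p a) ∧ ∑ a, p a = 1 ∧
    ∀ m, lam m ≤ ρ * ((∑ a, p a * (μ a m : ℝ)) / ∑ a, p a * (T a : ℝ))

/-! ### Bounds on the average backlog -/

/-- All backlogs are integrable, and for every `R > 0`
`(1/R) ∑_{r<R} ∑_m w_m E[Q_m[r]] ≤ c`. -/
def MeanBacklogLE {M : ℕ} {𝒜 : Type*} {Ω : Type*} [MeasurableSpace Ω] (P : Measure Ω)
    (T : 𝒜 → ℕ) (μ : 𝒜 → Fin M → ℕ) (A : ℕ → Ω → Fin M → ℕ) (α : ℕ → Ω → 𝒜)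
    (w : Fin M → ℝ) (c : ℝ) : Prop :=
  (∀ r m, Integrable (fun ω => (queue T μ A α r ω m : ℝ)) P) ∧
    ∀ R : ℕ, 0 < R →
      (1 / (R : ℝ)) * ∑ r ∈ Finset.range R, ∑ m, w m * ∫ ω, (queue T μ A α r ω m : ℝ) ∂P ≤ c

/-- With probability one `limsup_R (1/R) ∑_{r<R} ∑_m w_m Q_m[r] ≤ c`; the limsup is taken in the
extended reals. -/
def PathBacklogLE {M : ℕ} {𝒜 : Type*} {Ω : Type*} [MeasurableSpace Ω] (P : Measure Ω)
    (T : 𝒜 → ℕ) (μ : 𝒜 → Fin M → ℕ) (A : ℕ → Ω → Fin M → ℕ) (α : ℕ → Ω → 𝒜)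
    (w : Fin M → ℝ) (c : ℝ) : Prop :=
  ∀ᵐ ω ∂P, limsup (fun R : ℕ =>
    (((1 / (R : ℝ)) * ∑ r ∈ Finset.range R, ∑ m, w m * (queue T μ A α r ω m : ℝ) : ℝ) : EReal))
      atTop ≤ (c : EReal)

/-- The weighted average backlog is at most `κ B`, in mean and almost surely, for every admissible
constant `B`. -/
def WeightedBacklogBound {M : ℕ} {𝒜 : Type*} {Ω : Type*} [MeasurableSpace Ω] (P : Measure Ω)
    (T : 𝒜 → ℕ) (μ : 𝒜 → Fin M → ℕ) (lam : Fin M → ℝ) (A : ℕ → Ω → Fin M → ℕ)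
    (α : ℕ → Ω → 𝒜) (κ : ℝ) : Prop :=
  ∀ B : ℝ,
    (BoundGivenBacklog P T μ A α B → MeanBacklogLE P T μ A α lam (κ * B)) ∧
    (BoundGivenBacklog P T μ A α B → IsBacklogBased P T μ A α →
      PathBacklogLE P T μ A α lam (κ * B)) ∧
    (BoundGivenHistory P T μ A α B → PathBacklogLE P T μ A α lam (κ * B))

end

end IndexCoding

open IndexCoding

/-! The proof is a drift argument for L[r] = ½ Σ Q_m[r]². Squaring the queue recursion gives L[r+1]
≤ L[r] + Y[r] + N[r] - G[r], with noise N = Σ Q_m (a_m - λ_m T(α)) and gain G = Σ Q_m (μ_m(α) - λ_m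
T(α)). Given what is known when frame r starts, N has mean zero: the frame length is then decided,
and each slot's arrivals are independent of the past (`condExp_driftNoise`).

Write λ = ρ w with w in the capacity region. Along one typical path of a stabilizing policy, a limit
point p of the empirical action frequencies satisfies w_m ≤ Σ p μ_m / Σ p T
(`exists_stationary_of_path`). A max-weight action does at least as well as p, so G ≥ T* (1-ρ) Σ w_m
Q_m under Algorithm 1 and G ≥ (1-ρ) Σ w_m Q_m under Algorithm 2 (`maxWeight1_drift_of_le`,
`maxWeight2_drift_of_le`). Taking expectations and telescoping bounds the mean backlog.

For the almost sure bound the inequality is telescoped path by path, so the averages of N and of Y -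
E[Y | H_r] must vanish. The latter is a bounded martingale difference. N is only bounded by a
multiple of the total backlog, and the estimate E L[r] = O(r) from the plain drift is too weak to
make Σ E N[r]² / r² converge. But a gain proportional to the total backlog gives L² a negative drift
of order L^{3/2}, which beats the positive terms of order L. Hence E L[r]² = O(r)
(`exists_integral_lyapunov_sq_le`), so E N[r]² = O(√r), and the strong law
`tendsto_average_martingale_difference` applies. Flows of rate zero almost surely never queue, so Σ
w_m Q_m does control the total backlog.

The σ-algebras of Q[r] need not form a filtration, hence the role of H_r. At the start of a frame
the conditional mean of Y is a function of the action, so when the law of the action sees the past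
only through Q[r], conditioning on Q[r] or on H_r gives the same value
(`boundGivenHistory_of_backlogBased`). -/

namespace IndexCoding

/-! ### Sample-path estimates -/

section Path

variable {M : ℕ} {𝒜 : Type*} (T : 𝒜 → ℕ) (μ : 𝒜 → Fin M → ℕ)

theorem le_frameStart (hT : ∀ a, 1 ≤ T a) (α : ℕ → 𝒜) (r : ℕ) : r ≤ frameStart T α r := by
  induction r with
  | zero => simp
  | succ r ih => have := hT (α r); simp only [frameStart]; omega

theorem frameStart_eq_sum (α : ℕ → 𝒜) (R : ℕ) :
    frameStart T α R = ∑ r ∈ Finset.range R, T (α r) := by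
  induction R with
  | zero => simp [frameStart]
  | succ R ih => rw [frameStart, ih, Finset.sum_range_succ]

theorem frameArrivals_le (α : ℕ → 𝒜) {A : ℕ → Fin M → ℕ} (hA : ∀ t m, A t m ≤ 1) (r : ℕ)
    (m : Fin M) : frameArrivals T α A r m ≤ T (α r) := by
  refine (Finset.sum_le_card_nsmul _ _ 1 fun τ _ => hA τ m).trans ?_
  simp

theorem backlog_le {K : ℕ} (hK : ∀ a, T a ≤ K) (α : ℕ → 𝒜) {A : ℕ → Fin M → ℕ}
    (hA : ∀ t m, A t m ≤ 1) (r : ℕ) (m : Fin M) : backlog T μ α A r m ≤ r * K := by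
  induction r with
  | zero => simp [backlog]
  | succ r ih =>
    have := (frameArrivals_le T α hA r m).trans (hK _)
    simp only [backlog, Nat.succ_mul]; omega

/-- Packets that have arrived are either still queued or have been cleared. -/
theorem sum_arrivals_le_backlog (α : ℕ → 𝒜) (A : ℕ → Fin M → ℕ) (R : ℕ) (m : Fin M) :
    ∑ τ ∈ Finset.range (frameStart T α R), A τ m ≤
      backlog T μ α A R m + ∑ r ∈ Finset.range R, μ (α r) m := by
  induction R with
  | zero => simp [frameStart]
  | succ R ih =>
    have h : ∑ τ ∈ Finset.range (frameStart T α (R + 1)), A τ m =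
        ∑ τ ∈ Finset.range (frameStart T α R), A τ m + frameArrivals T α A R m := by
      rw [frameArrivals, frameStart, Finset.sum_range_add_sum_Ico _ (Nat.le_add_right _ _)]
    rw [h, Finset.sum_range_succ]
    simp only [backlog]
    omega

theorem backlog_eq_zero (α : ℕ → 𝒜) {A : ℕ → Fin M → ℕ} {m : Fin M} (hA : ∀ t, A t m = 0)
    (r : ℕ) : backlog T μ α A r m = 0 := by
  induction r with
  | zero => rfl
  | succ r ih => simp [backlog, ih, frameArrivals, hA]

/-- If μ ≤ Q, expanding the square leaves only the term -2aμ to discard. If Q ≤ μ, the left side is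
a², and the right side exceeds it by (Q - μ)² + 2Qa. -/
theorem sq_queue_step_le (Q μ a : ℕ) :
    (((Q - μ + a : ℕ) : ℝ)) ^ 2 ≤ (Q : ℝ) ^ 2 + (a ^ 2 + μ ^ 2) + 2 * (Q * (a - μ)) := by
  have ha : (0 : ℝ) ≤ a := a.cast_nonneg
  have hQ : (0 : ℝ) ≤ Q := Q.cast_nonneg
  have hμ : (0 : ℝ) ≤ μ := μ.cast_nonneg
  rcases le_total μ Q with h | h
  · push_cast [Nat.cast_sub h]
    nlinarith [mul_nonneg ha hμ]
  · rw [Nat.sub_eq_zero_of_le h]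
    push_cast
    nlinarith [sq_nonneg ((Q : ℝ) - μ), mul_nonneg hQ ha]

end Path

/-! ### Consequences of the max-weight rules -/

section MaxWeight

variable {M : ℕ} {𝒜 : Type*} [Fintype 𝒜] (T : 𝒜 → ℕ) (μ : 𝒜 → Fin M → ℕ)

theorem one_le_mean_frame (hT : ∀ a, 1 ≤ T a) {p : 𝒜 → ℝ} (hp : ∀ a, 0 ≤ p a)
    (hp1 : ∑ a, p a = 1) : 1 ≤ ∑ a, p a * (T a : ℝ) := by
  rw [← hp1]
  refine Finset.sum_le_sum fun a _ => le_mul_of_one_le_right (hp a) ?_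
  exact_mod_cast hT a

/-- A maximum is at least the average under `p`, and the objective of Algorithm 1 is linear in the
pair (μ, T). -/
theorem maxWeight1_drift {lam : Fin M → ℝ} {p : 𝒜 → ℝ} (hp : ∀ a, 0 ≤ p a)
    (hp1 : ∑ a, p a = 1) (q : Fin M → ℝ) {b : 𝒜}
    (hb : IsMaxOn (fun a : 𝒜 => ∑ m, q m * ((μ a m : ℝ) - lam m * T a)) Set.univ b) :
    ∑ m, q m * (∑ a, p a * (μ a m : ℝ) - lam m * ∑ a, p a * (T a : ℝ)) ≤
      ∑ m, q m * ((μ b m : ℝ) - lam m * T b) := by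
  calc ∑ m, q m * (∑ a, p a * (μ a m : ℝ) - lam m * ∑ a, p a * (T a : ℝ))
      = ∑ a, p a * ∑ m, q m * ((μ a m : ℝ) - lam m * T a) := by
        simp_rw [Finset.mul_sum, ← Finset.sum_sub_distrib, Finset.mul_sum]
        rw [Finset.sum_comm]
        exact Finset.sum_congr rfl fun a _ => Finset.sum_congr rfl fun m _ => by ring
    _ ≤ ∑ a, p a * ∑ m, q m * ((μ b m : ℝ) - lam m * T b) :=
        Finset.sum_le_sum fun a _ => mul_le_mul_of_nonneg_left (hb (Set.mem_univ a)) (hp a)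
    _ = _ := by rw [← Finset.sum_mul, hp1, one_mul]

/-- The ratio Σ p μ / Σ p T is the average of the ratios μ(a)/T(a) with weights proportional to p(a)
T(a), so the maximizer of the ratio objective beats it. Multiplying by the chosen frame size returns
to the drift. -/
theorem maxWeight2_drift (hT : ∀ a, 1 ≤ T a) {lam : Fin M → ℝ} {p : 𝒜 → ℝ} (hp : ∀ a, 0 ≤ p a)
    (hp1 : ∑ a, p a = 1) (q : Fin M → ℝ) {b : 𝒜}
    (hb : IsMaxOn (fun a : 𝒜 => ∑ m, q m * ((μ a m : ℝ) / T a)) Set.univ b) :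
    T b * ∑ m, q m * ((∑ a, p a * (μ a m : ℝ)) / (∑ a, p a * (T a : ℝ)) - lam m) ≤
      ∑ m, q m * ((μ b m : ℝ) - lam m * T b) := by
  have hTs : 0 < ∑ a, p a * (T a : ℝ) := one_pos.trans_le (one_le_mean_frame T hT hp hp1)
  have hT0 : ∀ a, (0 : ℝ) < T a := fun a => by exact_mod_cast hT a
  have key : ∑ m, q m * ((∑ a, p a * (μ a m : ℝ)) / (∑ a, p a * (T a : ℝ))) ≤
      ∑ m, q m * ((μ b m : ℝ) / T b) := by
    simp_rw [← mul_div_assoc]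
    rw [← Finset.sum_div, div_le_iff₀ hTs, Finset.mul_sum]
    calc ∑ m, q m * ∑ a, p a * (μ a m : ℝ)
        = ∑ a, p a * T a * ∑ m, q m * ((μ a m : ℝ) / T a) := by
          simp_rw [Finset.mul_sum]
          rw [Finset.sum_comm]
          refine Finset.sum_congr rfl fun a _ => Finset.sum_congr rfl fun m _ => ?_
          have := (hT0 a).ne'
          field_simp
      _ ≤ ∑ a, p a * T a * ∑ m, q m * ((μ b m : ℝ) / T b) :=
          Finset.sum_le_sum fun a _ => mul_le_mul_of_nonneg_left (hb (Set.mem_univ a))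
            (mul_nonneg (hp a) (hT0 a).le)
      _ = _ := Finset.sum_congr rfl fun a _ => by simp_rw [mul_div_assoc]; ring
  calc (T b : ℝ) * ∑ m, q m * ((∑ a, p a * (μ a m : ℝ)) / (∑ a, p a * (T a : ℝ)) - lam m)
      = T b * (∑ m, q m * ((∑ a, p a * (μ a m : ℝ)) / (∑ a, p a * (T a : ℝ))) -
          ∑ m, q m * lam m) := by
        rw [← Finset.sum_sub_distrib]; simp_rw [mul_sub]
    _ ≤ T b * (∑ m, q m * ((μ b m : ℝ) / T b) - ∑ m, q m * lam m) := by
        have := (hT0 b).le; gcongr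
    _ = _ := by
        rw [← Finset.sum_sub_distrib, Finset.mul_sum]
        refine Finset.sum_congr rfl fun m _ => ?_
        have := (hT0 b).ne'
        field_simp

/-- If `w ≤ (∑ p μ) / (∑ p T)` componentwise, then under Algorithm 1 the drift at load `ρ • w` is
at least `(∑ p T) (1 - ρ) ∑ w q`. -/
theorem maxWeight1_drift_of_le {w lam : Fin M → ℝ} {ρ : ℝ} (hT : ∀ a, 1 ≤ T a) {p : 𝒜 → ℝ}
    (hp : IsStationaryPolicy T μ w 1 p) (hlam : lam = ρ • w) {q : Fin M → ℝ}
    (hq : ∀ m, 0 ≤ q m) {b : 𝒜}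
    (hb : IsMaxOn (fun a : 𝒜 => ∑ m, q m * ((μ a m : ℝ) - lam m * T a)) Set.univ b) :
    (∑ a, p a * (T a : ℝ)) * (1 - ρ) * ∑ m, w m * q m ≤
      ∑ m, q m * ((μ b m : ℝ) - lam m * T b) := by
  obtain ⟨hp0, hp1, hp2⟩ := hp
  have hTs : 0 < ∑ a, p a * (T a : ℝ) := one_pos.trans_le (one_le_mean_frame T hT hp0 hp1)
  refine le_trans ?_ (maxWeight1_drift T μ hp0 hp1 q hb)
  rw [Finset.mul_sum]
  refine Finset.sum_le_sum fun m _ => ?_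
  have h := hp2 m
  rw [one_mul, le_div_iff₀ hTs] at h
  rw [hlam, Pi.smul_apply, smul_eq_mul]
  nlinarith [mul_le_mul_of_nonneg_left h (hq m)]

theorem maxWeight2_drift_of_le {w lam : Fin M → ℝ} {ρ : ℝ} (hρ : ρ ≤ 1) (hw : ∀ m, 0 ≤ w m)
    (hT : ∀ a, 1 ≤ T a) {p : 𝒜 → ℝ}
    (hp : IsStationaryPolicy T μ w 1 p) (hlam : lam = ρ • w) {q : Fin M → ℝ}
    (hq : ∀ m, 0 ≤ q m) {b : 𝒜}
    (hb : IsMaxOn (fun a : 𝒜 => ∑ m, q m * ((μ a m : ℝ) / T a)) Set.univ b) :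
    (1 - ρ) * ∑ m, w m * q m ≤ ∑ m, q m * ((μ b m : ℝ) - lam m * T b) := by
  obtain ⟨hp0, hp1, hp2⟩ := hp
  refine le_trans ?_ (maxWeight2_drift T μ hT hp0 hp1 q hb)
  have h1 : (1 - ρ) * ∑ m, w m * q m ≤
      ∑ m, q m * ((∑ a, p a * (μ a m : ℝ)) / (∑ a, p a * (T a : ℝ)) - lam m) := by
    rw [Finset.mul_sum]
    refine Finset.sum_le_sum fun m _ => ?_
    have h := hp2 m
    rw [one_mul] at h
    rw [hlam, Pi.smul_apply, smul_eq_mul]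
    nlinarith [mul_le_mul_of_nonneg_left h (hq m)]
  -- The sign allows the factor `T b` to be lowered to 1. The chosen frame may be short, so no
  -- factor Σ p T is gained here.
  have h0 : 0 ≤ (1 - ρ) * ∑ m, w m * q m :=
    mul_nonneg (by linarith) (Finset.sum_nonneg fun m _ => mul_nonneg (hw m) (hq m))
  exact h1.trans (le_mul_of_one_le_left (h0.trans h1) (by exact_mod_cast hT b))

end MaxWeight

/-! ### The capacity region is contained in the stationary region -/

section Capacity

variable {M : ℕ} {𝒜 : Type*} [Fintype 𝒜] (T : 𝒜 → ℕ) (μ : 𝒜 → Fin M → ℕ)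

/-- The fraction of the frames before `R` on which action `a` is used. -/
noncomputable def actionFreq {𝒜 : Type*} (α : ℕ → 𝒜) (R : ℕ) (a : 𝒜) : ℝ := by
  classical exact (∑ r ∈ Finset.range R, if α r = a then (1 : ℝ) else 0) / R

theorem sum_actionFreq_mul (α : ℕ → 𝒜) (R : ℕ) (f : 𝒜 → ℝ) :
    ∑ a, actionFreq α R a * f a = (∑ r ∈ Finset.range R, f (α r)) / R := by
  classical
  unfold actionFreq
  simp_rw [div_mul_eq_mul_div, Finset.sum_mul]
  rw [← Finset.sum_div, Finset.sum_comm]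
  simp

theorem actionFreq_mem_stdSimplex (α : ℕ → 𝒜) (R : ℕ) :
    actionFreq α (R + 1) ∈ stdSimplex ℝ 𝒜 := by
  refine ⟨fun a => ?_, ?_⟩
  · unfold actionFreq
    exact div_nonneg (Finset.sum_nonneg fun r _ => by split_ifs <;> simp) (Nat.cast_nonneg _)
  · have h := sum_actionFreq_mul α (R + 1) fun _ => 1
    simp only [mul_one] at h
    rw [h]
    simp [Nat.cast_add_one_ne_zero]

/-- A sample path along which the queues are rate stable and the arrivals have rates `lam` yields
stationary probabilities supporting `lam`. -/
theorem exists_stationary_of_path (hT : ∀ a, 1 ≤ T a) {lam : Fin M → ℝ} (α : ℕ → 𝒜)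
    (A : ℕ → Fin M → ℕ)
    (hA : ∀ m, Tendsto (fun n : ℕ => (∑ t ∈ Finset.range n, (A t m : ℝ)) / n) atTop (𝓝 (lam m)))
    (hQ : ∀ m, Tendsto (fun R : ℕ => (backlog T μ α A R m : ℝ) / R) atTop (𝓝 0)) :
    ∃ p, IsStationaryPolicy T μ lam 1 p := by
  -- Frequencies are taken over `R + 1` frames, since at `R = 0` division by zero would leave the
  -- simplex.
  obtain ⟨p, hp, φ, hφ, hlim⟩ := (isCompact_stdSimplex ℝ 𝒜).tendsto_subseq
    (actionFreq_mem_stdSimplex α)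
  have hφ1 : Tendsto (fun n => φ n + 1) atTop atTop :=
    (tendsto_add_atTop_nat 1).comp hφ.tendsto_atTop
  have hpT := one_le_mean_frame T hT hp.1 hp.2
  have hlimf : ∀ f : 𝒜 → ℝ, Tendsto (fun n => (∑ r ∈ Finset.range (φ n + 1), f (α r)) /
      ((φ n + 1 : ℕ) : ℝ)) atTop (𝓝 (∑ a, p a * f a)) := by
    intro f
    simp_rw [← sum_actionFreq_mul]
    exact tendsto_finsetSum _ fun a _ => ((tendsto_pi_nhds.1 hlim) a).mul_const _
  have hstart : Tendsto (frameStart T α) atTop atTop :=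
    tendsto_atTop_mono (le_frameStart T hT α) tendsto_id
  refine ⟨p, hp.1, hp.2, fun m => ?_⟩
  rw [one_mul, le_div_iff₀ (one_pos.trans_le hpT)]
  -- Arrivals per frame are arrivals per slot times slots per frame. They are at most backlog plus
  -- clearances per frame, and the backlog share tends to 0.
  have h1 := ((hA m).comp (hstart.comp hφ1)).mul (hlimf fun a => (T a : ℝ))
  have h2 := ((hQ m).comp hφ1).add (hlimf fun a => (μ a m : ℝ))
  rw [zero_add] at h2
  refine le_of_tendsto_of_tendsto' h1 h2 fun n => ?_
  have hs : (0 : ℝ) < frameStart T α (φ n + 1) := by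
    exact_mod_cast (Nat.succ_pos _).trans_le (le_frameStart T hT α (φ n + 1))
  have hR : (0 : ℝ) < ((φ n + 1 : ℕ) : ℝ) := by exact_mod_cast Nat.succ_pos _
  have hsum : (∑ r ∈ Finset.range (φ n + 1), (T (α r) : ℝ)) = frameStart T α (φ n + 1) := by
    rw [frameStart_eq_sum]; push_cast; rfl
  have h := sum_arrivals_le_backlog T μ α A (φ n + 1) m
  have h' : (∑ τ ∈ Finset.range (frameStart T α (φ n + 1)), (A τ m : ℝ)) ≤
      backlog T μ α A (φ n + 1) m + ∑ r ∈ Finset.range (φ n + 1), (μ (α r) m : ℝ) := by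
    exact_mod_cast h
  simp only [Function.comp]
  rw [hsum, div_mul_div_cancel₀ hs.ne', ← add_div]
  exact div_le_div_of_nonneg_right h' hR.le

/-- Almost every path is rate stable and obeys the strong law for the arrivals; a single such path
suffices. -/
theorem exists_stationary_of_mem_capacityRegion (hT : ∀ a, 1 ≤ T a) {lam : Fin M → ℝ}
    (h : lam ∈ capacityRegion T μ) : ∃ p, IsStationaryPolicy T μ lam 1 p := by
  obtain ⟨Ω, mΩ, P, hP, A, α, hiid, -, hstab⟩ := h
  have hA : ∀ᵐ ω ∂P, ∀ m, Tendsto (fun n : ℕ => (∑ t ∈ Finset.range n, (A t ω m : ℝ)) / n)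
      atTop (𝓝 (lam m)) := by
    rw [ae_all_iff]
    intro m
    have hg : Measurable fun v : Fin M → ℕ => (v m : ℝ) :=
      measurable_from_nat.comp (measurable_pi_apply m)
    have := strong_law_ae_real (fun t ω => (A t ω m : ℝ)) (hiid.integrable 0 m)
      (fun i j hij => (hiid.indep.indepFun hij).comp hg hg)
      (fun i => (hiid.identDistrib i).comp hg)
    rwa [hiid.mean 0 m] at this
  obtain ⟨ω, h1, h2⟩ := (hA.and (ae_all_iff.2 hstab)).exists
  exact exists_stationary_of_path T μ hT (fun r => α r ω) (fun t => A t ω) h1 h2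

theorem IsStationaryPolicy.smul {lam : Fin M → ℝ} {p : 𝒜 → ℝ}
    (hp : IsStationaryPolicy T μ lam 1 p) {ρ : ℝ} (hρ : 0 ≤ ρ) :
    IsStationaryPolicy T μ (ρ • lam) ρ p :=
  ⟨hp.1, hp.2.1, fun m => by
    have := mul_le_mul_of_nonneg_left (hp.2.2 m) hρ
    rwa [one_mul] at this⟩

end Capacity

/-! ### A strong law for martingale differences -/

section StrongLaw

/-- Kronecker's lemma with weights `r + 1`. -/
theorem tendsto_average_of_tendsto_sum_div {x : ℕ → ℝ} {l : ℝ}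
    (h : Tendsto (fun n => ∑ r ∈ Finset.range n, x r / (r + 1)) atTop (𝓝 l)) :
    Tendsto (fun R : ℕ => (1 / (R : ℝ)) * ∑ r ∈ Finset.range R, x r) atTop (𝓝 0) := by
  set s : ℕ → ℝ := fun n => ∑ r ∈ Finset.range n, x r / (r + 1) with hs
  -- Summation by parts: the average of `x` is `s R` minus the Cesàro mean of `s`, and both converge
  -- to `l`.
  have key : ∀ R : ℕ, ∑ r ∈ Finset.range R, x r = R * s R - ∑ r ∈ Finset.range R, s r := by
    intro R
    induction R with
    | zero => simp
    | succ R ih =>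
      have : s (R + 1) = s R + x R / (R + 1) := Finset.sum_range_succ _ _
      rw [Finset.sum_range_succ, ih, Finset.sum_range_succ, this]
      have : (R : ℝ) + 1 ≠ 0 := Nat.cast_add_one_ne_zero R
      push_cast
      field_simp
      ring
  have h0 := h.sub h.cesaro
  rw [sub_self] at h0
  refine h0.congr' ?_
  filter_upwards [eventually_gt_atTop 0] with R hR
  have : (R : ℝ) ≠ 0 := by exact_mod_cast hR.ne'
  rw [key, hs]
  field_simp

variable {Ω : Type*} {mΩ : MeasurableSpace Ω} {P : Measure Ω} [IsProbabilityMeasure P]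

theorem integrable_of_abs_le {f : Ω → ℝ} (hf : Measurable f) {b : ℝ} (hb : ∀ ω, |f ω| ≤ b) :
    Integrable f P :=
  Integrable.of_bound hf.aestronglyMeasurable b (ae_of_all _ hb)

theorem integrable_of_ae_abs_le {f : Ω → ℝ} (hf : Measurable f) {b : ℝ} (hb : ∀ᵐ ω ∂P, |f ω| ≤ b) :
    Integrable f P :=
  Integrable.of_bound hf.aestronglyMeasurable b hb

theorem integral_mul_eq_zero_of_condExp {m : MeasurableSpace Ω} (hm : m ≤ mΩ) {Z X : Ω → ℝ}
    (hZ : Measurable[m] Z) (hZX : Integrable (Z * X) P) (hX : Integrable X P)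
    (h : P[X | m] =ᵐ[P] 0) : ∫ ω, Z ω * X ω ∂P = 0 := by
  have h1 : P[Z * X | m] =ᵐ[P] 0 := by
    filter_upwards [condExp_mul_of_stronglyMeasurable_left hZ.stronglyMeasurable hZX hX, h]
      with ω h1 h2
    simp [h1, h2]
  have h2 := integral_condExp (μ := P) (f := Z * X) hm
  rw [integral_congr_ae h1] at h2
  simpa using h2.symm

/-- Averages of bounded martingale differences `X r` vanish almost surely if
`∑ E[X r ^ 2] / (r + 1) ^ 2 < ∞`. -/
theorem tendsto_average_martingale_difference (𝒢 : Filtration ℕ mΩ) {X : ℕ → Ω → ℝ} {b v : ℕ → ℝ}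
    (hX : ∀ r, Measurable[𝒢 (r + 1)] (X r)) (hb : ∀ r, ∀ᵐ ω ∂P, |X r ω| ≤ b r)
    (h0 : ∀ r, P[X r | 𝒢 r] =ᵐ[P] 0) (hv : ∀ r, ∫ ω, X r ω ^ 2 ∂P ≤ v r)
    (hsum : Summable fun r : ℕ => v r / ((r : ℝ) + 1) ^ 2) :
    ∀ᵐ ω ∂P, Tendsto (fun R : ℕ => (1 / (R : ℝ)) * ∑ r ∈ Finset.range R, X r ω) atTop (𝓝 0) := by
  set S : ℕ → Ω → ℝ := fun n ω => ∑ r ∈ Finset.range n, X r ω / (r + 1) with hS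
  have hSmeas : ∀ n, Measurable[𝒢 n] (S n) := by
    intro n
    refine Finset.measurable_fun_sum _ fun r hr => ?_
    exact ((hX r).mono (𝒢.mono (Finset.mem_range.1 hr)) le_rfl).div_const _
  have hXm : ∀ r, Measurable (X r) := fun r => (hX r).mono (𝒢.le _) le_rfl
  have hSm : ∀ n, Measurable (S n) := fun n => (hSmeas n).mono (𝒢.le _) le_rfl
  have hSb : ∀ n, ∀ᵐ ω ∂P, |S n ω| ≤ ∑ r ∈ Finset.range n, b r := by
    intro n
    filter_upwards [ae_all_iff.2 hb] with ω hb
    refine (Finset.abs_sum_le_sum_abs _ _).trans (Finset.sum_le_sum fun r _ => ?_)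
    rw [abs_div, abs_of_pos (Nat.cast_add_one_pos r : (0 : ℝ) < r + 1)]
    exact (div_le_self (abs_nonneg _) (by simp)).trans (hb r)
  have hXi : ∀ r, Integrable (X r) P := fun r => integrable_of_ae_abs_le (hXm r) (hb r)
  have hSi : ∀ n, Integrable (S n) P := fun n => integrable_of_ae_abs_le (hSm n) (hSb n)
  have hsucc : ∀ n, S (n + 1) = S n + fun ω => X n ω / (n + 1) :=
    fun n => funext fun ω => Finset.sum_range_succ _ _
  have hmart : Martingale S 𝒢 P := by
    refine martingale_nat (fun n => (hSmeas n).stronglyMeasurable) hSi fun n => ?_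
    have h1 : P[fun ω => X n ω / (n + 1) | 𝒢 n] =ᵐ[P] 0 := by
      have h2 := condExp_smul ((n : ℝ) + 1)⁻¹ (X n) (𝒢 n) (μ := P)
      have h3 : (((n : ℝ) + 1)⁻¹ • X n) = fun ω => X n ω / (n + 1) := by
        ext ω; simp [div_eq_inv_mul]
      rw [h3] at h2
      filter_upwards [h2, h0 n] with ω h2 h0
      simp [h2, h0]
    rw [hsucc]
    filter_upwards [condExp_add (hSi n) ((hXi n).div_const ((n : ℝ) + 1)) (𝒢 n), h1] with ω h2 h3
    rw [h2, Pi.add_apply, h3, condExp_of_stronglyMeasurable (𝒢.le n) (hSmeas n).stronglyMeasurable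
      (hSi n)]
    simp
  have hprod : ∀ n, Integrable (S n * X n) P := fun n =>
    integrable_of_ae_abs_le ((hSm n).mul (hXm n)) (b := (∑ r ∈ Finset.range n, b r) * b n) <| by
      filter_upwards [hSb n, hb n] with ω hS hX
      rw [Pi.mul_apply, abs_mul]
      exact mul_le_mul hS hX (abs_nonneg _) ((abs_nonneg _).trans hS)
  have hprod2 : ∀ n : ℕ, Integrable (fun ω => (2 / ((n : ℝ) + 1)) * (S n ω * X n ω)) P :=
    fun n => (hprod n).const_mul _
  have hXsq : ∀ n, Integrable (fun ω => X n ω ^ 2) P := fun n =>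
    integrable_of_ae_abs_le ((hXm n).pow_const 2) (b := b n ^ 2) <| by
      filter_upwards [hb n] with ω hX
      rw [abs_pow]; exact pow_le_pow_left₀ (abs_nonneg _) hX 2
  have hSsq : ∀ n, Integrable (fun ω => S n ω ^ 2) P := fun n =>
    integrable_of_ae_abs_le ((hSm n).pow_const 2) (b := (∑ r ∈ Finset.range n, b r) ^ 2) <| by
      filter_upwards [hSb n] with ω hS
      rw [abs_pow]; exact pow_le_pow_left₀ (abs_nonneg _) hS 2
  -- Martingale increments are orthogonal to the past, so the cross term integrates to zero and the
  -- variances add up.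
  have hL2 : ∀ n, ∫ ω, S n ω ^ 2 ∂P ≤ ∑ r ∈ Finset.range n, v r / ((r : ℝ) + 1) ^ 2 := by
    intro n
    induction n with
    | zero => simp [hS]
    | succ n ih =>
      have h1 : ∀ ω, S (n + 1) ω ^ 2 =
          S n ω ^ 2 + (2 / ((n : ℝ) + 1)) * (S n ω * X n ω) + X n ω ^ 2 / ((n : ℝ) + 1) ^ 2 := by
        intro ω
        rw [hsucc, Pi.add_apply]
        have : (n : ℝ) + 1 ≠ 0 := Nat.cast_add_one_ne_zero n
        field_simp
        ring
      simp_rw [h1]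
      have h2 : Integrable (fun ω => S n ω ^ 2 + (2 / ((n : ℝ) + 1)) * (S n ω * X n ω)) P :=
        (hSsq n).add (hprod2 n)
      rw [integral_add h2 ((hXsq n).div_const _), integral_add (hSsq n) (hprod2 n), integral_const_mul, integral_div,
        integral_mul_eq_zero_of_condExp (𝒢.le n) (hSmeas n) (hprod n) (hXi n) (h0 n),
        Finset.sum_range_succ, mul_zero, add_zero]
      have := hv n
      gcongr
  have hv0 : ∀ r, 0 ≤ v r := fun r => (integral_nonneg fun ω => sq_nonneg _).trans (hv r)
  -- The martingale convergence theorem asks for an L¹ bound; |s| ≤ 1 + s² derives it from the L²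
  -- bound.
  have hL1 : ∀ n, eLpNorm (S n) 1 P ≤
      ((1 + ∑' r : ℕ, v r / ((r : ℝ) + 1) ^ 2).toNNReal : NNReal) := by
    intro n
    rw [eLpNorm_one_eq_lintegral_enorm, ← ofReal_integral_norm_eq_lintegral_enorm (hSi n)]
    refine ENNReal.ofReal_le_ofReal ?_
    calc ∫ ω, ‖S n ω‖ ∂P ≤ ∫ ω, (1 + S n ω ^ 2) ∂P :=
          integral_mono (hSi n).norm ((integrable_const 1).add (hSsq n)) fun ω => by
            simp only [Real.norm_eq_abs]
            nlinarith [sq_abs (S n ω), sq_nonneg (|S n ω| - 1)]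
      _ = 1 + ∫ ω, S n ω ^ 2 ∂P := by
          rw [integral_add (integrable_const 1) (hSsq n)]; simp
      _ ≤ _ := by
          have := (hL2 n).trans (hsum.sum_le_tsum (Finset.range n)
            fun r _ => div_nonneg (hv0 r) (sq_nonneg _))
          gcongr
  filter_upwards [hmart.submartingale.ae_tendsto_limitProcess hL1] with ω hω
  exact tendsto_average_of_tendsto_sum_div hω

end StrongLaw

/-! ### The information carried by past frames -/

section History

variable {M : ℕ} {𝒜 : Type*} {Ω : Type*} {T : 𝒜 → ℕ} {α : ℕ → Ω → 𝒜}

/-- The backlog is adapted to every filtration that sees the past actions and arrivals. -/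
theorem measurable_queue (μ : 𝒜 → Fin M → ℕ) {A : ℕ → Ω → Fin M → ℕ} (𝒦 : ℕ → MeasurableSpace Ω)
    (hmono : Monotone 𝒦) (hα : ∀ r, @Measurable Ω 𝒜 (𝒦 (r + 1)) ⊤ (α r))
    (ha : ∀ r, Measurable[𝒦 (r + 1)] (arrivals T A α r)) (r : ℕ) :
    Measurable[𝒦 r] (queue T μ A α r) := by
  induction r with
  | zero => exact @measurable_const _ _ _ (𝒦 0) (fun _ => 0)
  | succ r ih =>
    refine @measurable_pi_lambda Ω (Fin M) _ (𝒦 (r + 1)) _ _ fun m => ?_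
    have h1 : Measurable[𝒦 (r + 1)] fun ω => queue T μ A α r ω m :=
      (measurable_pi_apply m).comp (ih.mono (hmono (Nat.le_succ r)) le_rfl)
    have h2 : Measurable[𝒦 (r + 1)] fun ω => μ (α r ω) m :=
      (@measurable_from_top 𝒜 ℕ _ fun a => μ a m).comp (hα r)
    have h3 : Measurable[𝒦 (r + 1)] fun ω => arrivals T A α r ω m :=
      (measurable_pi_apply m).comp (ha r)
    exact (h1.sub h2).add h3

theorem historyInfo_mono (T : 𝒜 → ℕ) (A : ℕ → Ω → Fin M → ℕ) (α : ℕ → Ω → 𝒜) :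
    Monotone (historyInfo T A α) := fun _ _ hrs =>
  iSup_mono fun _ => iSup_mono' fun hs => ⟨lt_of_lt_of_le hs hrs, le_rfl⟩

theorem measurable_action_historyInfo (T : 𝒜 → ℕ) (A : ℕ → Ω → Fin M → ℕ) (α : ℕ → Ω → 𝒜)
    (r : ℕ) : @Measurable Ω 𝒜 (historyInfo T A α (r + 1)) ⊤ (α r) := by
  let _ : MeasurableSpace 𝒜 := ⊤
  exact measurable_iff_comap_le.2 (le_sup_left.trans (le_iSup₂_of_le r (Nat.lt_succ_self r) le_rfl))

theorem measurable_arrivals_historyInfo (T : 𝒜 → ℕ) (A : ℕ → Ω → Fin M → ℕ) (α : ℕ → Ω → 𝒜)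
    (r : ℕ) : Measurable[historyInfo T A α (r + 1)] (arrivals T A α r) :=
  measurable_iff_comap_le.2 (le_sup_right.trans (le_iSup₂_of_le r (Nat.lt_succ_self r) le_rfl))

end History

/-! ### Information available at the start of a frame -/

section FrameInfo

variable {M : ℕ} {𝒜 : Type*} [Fintype 𝒜] {Ω : Type*} {mΩ : MeasurableSpace Ω}

/-- The sets `S` for which `S ∩ {t[r] = t}` is decided at slot `t`, for every `t`. -/
def frameInfo (ℱ : Filtration ℕ mΩ) (T : 𝒜 → ℕ) (α : ℕ → Ω → 𝒜)
    (h : ∀ r t a, MeasurableSet[ℱ t] {ω | frameStart T (fun s => α s ω) r = t ∧ α r ω = a}) :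
    Filtration ℕ mΩ where
  seq r :=
    { MeasurableSet' := fun S => ∀ t, MeasurableSet[ℱ t]
        (S ∩ {ω | frameStart T (fun s => α s ω) r = t})
      measurableSet_empty := fun t => by rw [Set.empty_inter]; exact @MeasurableSet.empty Ω (ℱ t)
      measurableSet_compl := fun S hS t => by
        have h1 : MeasurableSet[ℱ t] {ω | frameStart T (fun s => α s ω) r = t} := by
          have : {ω | frameStart T (fun s => α s ω) r = t} =
              ⋃ a, {ω | frameStart T (fun s => α s ω) r = t ∧ α r ω = a} := by
            ext ω; simp
          rw [this]
          exact MeasurableSet.iUnion fun a => h r t a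
        have h2 : Sᶜ ∩ {ω | frameStart T (fun s => α s ω) r = t} =
            {ω | frameStart T (fun s => α s ω) r = t} \
              (S ∩ {ω | frameStart T (fun s => α s ω) r = t}) := by
          ext ω; simp only [Set.mem_inter_iff, Set.mem_sdiff, Set.mem_compl_iff]; tauto
        rw [h2]
        exact h1.diff (hS t)
      measurableSet_iUnion := fun f hf t => by
        rw [Set.iUnion_inter]
        exact MeasurableSet.iUnion fun i => hf i t }
  mono' := by
    -- Frame `r + 1` starts at `t` exactly when frame `r` started at some `u` with an action `a`
    -- such that `u + T a = t`; this is already decided at slot `u ≤ t`.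
    refine monotone_nat_of_le_succ fun r S hS t => ?_
    have : S ∩ {ω | frameStart T (fun s => α s ω) (r + 1) = t} =
        ⋃ (u : ℕ) (a : 𝒜) (_ : u + T a = t), (S ∩ {ω | frameStart T (fun s => α s ω) r = u}) ∩
          {ω | frameStart T (fun s => α s ω) r = u ∧ α r ω = a} := by
      ext ω
      simp only [frameStart, Set.mem_inter_iff, Set.mem_ofPred_eq, Set.mem_iUnion, exists_prop]
      constructor
      · rintro ⟨h1, h2⟩
        exact ⟨_, _, h2, ⟨h1, rfl⟩, rfl, rfl⟩
      · rintro ⟨u, a, h1, ⟨h2, rfl⟩, -, rfl⟩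
        exact ⟨h2, h1⟩
    rw [this]
    refine MeasurableSet.iUnion fun u => MeasurableSet.iUnion fun a => MeasurableSet.iUnion
      fun hu => ?_
    exact ℱ.mono (by omega : u ≤ t) _ (MeasurableSet.inter (hS u) (h r u a))
  le' := by
    intro r S hS
    have : S = ⋃ t, S ∩ {ω | frameStart T (fun s => α s ω) r = t} := by
      ext ω; simp
    rw [this]
    exact MeasurableSet.iUnion fun t => ℱ.le t _ (hS t)

variable {ℱ : Filtration ℕ mΩ} {T : 𝒜 → ℕ} {α : ℕ → Ω → 𝒜}
  (h : ∀ r t a, MeasurableSet[ℱ t] {ω | frameStart T (fun s => α s ω) r = t ∧ α r ω = a})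

theorem measurableSet_frameInfo_inter {r : ℕ} {S : Set Ω}
    (hS : MeasurableSet[frameInfo ℱ T α h r] S) (t : ℕ) (a : 𝒜) : MeasurableSet[ℱ t]
      (S ∩ {ω | frameStart T (fun s => α s ω) r = t ∧ α r ω = a}) := by
  have : S ∩ {ω | frameStart T (fun s => α s ω) r = t ∧ α r ω = a} =
      (S ∩ {ω | frameStart T (fun s => α s ω) r = t}) ∩
        {ω | frameStart T (fun s => α s ω) r = t ∧ α r ω = a} := by
    ext ω; simp only [Set.mem_inter_iff, Set.mem_ofPred_eq]; tauto
  rw [this]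
  exact MeasurableSet.inter (hS t) (h r t a)

theorem measurable_action (r : ℕ) : @Measurable Ω 𝒜 (frameInfo ℱ T α h r) ⊤ (α r) := by
  let _ : MeasurableSpace 𝒜 := ⊤
  refine @measurable_to_countable' 𝒜 Ω _ _ (frameInfo ℱ T α h r) _ fun a t => ?_
  have : α r ⁻¹' {a} ∩ {ω | frameStart T (fun s => α s ω) r = t} =
      {ω | frameStart T (fun s => α s ω) r = t ∧ α r ω = a} := by
    ext ω; simp [and_comm]
  rw [this]
  exact h r t a

/-- Once the start slot and the action are fixed, the random window of slots becomes deterministic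
and ends before the next frame starts. -/
theorem measurable_arrivals {A : ℕ → Ω → Fin M → ℕ} (hA : ∀ t, Measurable[ℱ (t + 1)] (A t))
    (r : ℕ) : Measurable[frameInfo ℱ T α h (r + 1)] (arrivals T A α r) := by
  refine @measurable_to_countable' (Fin M → ℕ) Ω _ _ (frameInfo ℱ T α h (r + 1)) _ fun v t => ?_
  have : arrivals T A α r ⁻¹' {v} ∩ {ω | frameStart T (fun s => α s ω) (r + 1) = t} =
      ⋃ (u : ℕ) (a : 𝒜) (_ : u + T a = t),
        {ω | frameStart T (fun s => α s ω) r = u ∧ α r ω = a} ∩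
          (fun ω m => ∑ τ ∈ Finset.Ico u (u + T a), A τ ω m) ⁻¹' {v} := by
    ext ω
    simp only [frameStart, Set.mem_inter_iff, Set.mem_ofPred_eq, Set.mem_iUnion, exists_prop,
      Set.mem_preimage, Set.mem_singleton_iff]
    constructor
    · rintro ⟨h1, h2⟩
      exact ⟨_, _, h2, ⟨rfl, rfl⟩, h1⟩
    · rintro ⟨u, a, h1, ⟨rfl, rfl⟩, h2⟩
      exact ⟨h2, h1⟩
  rw [this]
  refine MeasurableSet.iUnion fun u => MeasurableSet.iUnion fun a => MeasurableSet.iUnion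
    fun hu => ?_
  refine MeasurableSet.inter (ℱ.mono (by omega : u ≤ t) _ (h r u a)) ?_
  have hmeas : Measurable[ℱ t] (fun ω m => ∑ τ ∈ Finset.Ico u (u + T a), A τ ω m) := by
    refine @measurable_pi_lambda Ω (Fin M) _ (ℱ t) _ _ fun m => ?_
    refine Finset.measurable_fun_sum _ fun τ hτ => ?_
    have hle : τ + 1 ≤ t := by have := (Finset.mem_Ico.1 hτ).2; omega
    exact (measurable_pi_apply m).comp ((hA τ).mono (ℱ.mono hle) le_rfl)
  exact hmeas (measurableSet_singleton v)

theorem historyInfo_le_frameInfo {A : ℕ → Ω → Fin M → ℕ}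
    (hA : ∀ t, Measurable[ℱ (t + 1)] (A t)) (r : ℕ) :
    historyInfo T A α r ≤ frameInfo ℱ T α h r := by
  refine iSup_le fun s => iSup_le fun hs => sup_le ?_ ?_
  · exact (measurable_action h s).comap_le.trans ((frameInfo ℱ T α h).mono hs.le)
  · exact (measurable_arrivals h hA s).comap_le.trans ((frameInfo ℱ T α h).mono hs)

end FrameInfo

/-! ### Conditional moments of the arrivals of a frame -/

section Moments

variable {M : ℕ} {𝒜 : Type*} [Fintype 𝒜] {Ω : Type*} {mΩ : MeasurableSpace Ω} {P : Measure Ω}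

theorem integral_mul_arrival {m' : MeasurableSpace Ω} (hm : m' ≤ mΩ) {Z : Ω → ℝ}
    (hZ : Measurable[m'] Z) {X : Ω → Fin M → ℕ} (hX : Measurable[mΩ] X)
    (hind : Indep m' (MeasurableSpace.comap X inferInstance) P) (m : Fin M) :
    ∫ ω, Z ω * (X ω m : ℝ) ∂P = (∫ ω, Z ω ∂P) * ∫ ω, (X ω m : ℝ) ∂P := by
  have hg : Measurable fun v : Fin M → ℕ => (v m : ℝ) :=
    measurable_from_nat.comp (measurable_pi_apply m)
  have hi : IndepFun Z (fun ω => (X ω m : ℝ)) P := by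
    rw [IndepFun_iff_Indep]
    refine indep_of_indep_of_le_left (indep_of_indep_of_le_right hind ?_) hZ.comap_le
    rw [show (fun ω => (X ω m : ℝ)) = (fun v : Fin M → ℕ => (v m : ℝ)) ∘ X from rfl,
      ← MeasurableSpace.comap_comp]
    exact MeasurableSpace.comap_mono hg.comap_le
  exact hi.integral_fun_mul_eq_mul_integral (hZ.mono hm le_rfl).aestronglyMeasurable
    (hg.comp hX).aestronglyMeasurable

variable [IsProbabilityMeasure P] {lam : Fin M → ℝ} {A : ℕ → Ω → Fin M → ℕ} {ℱ : Filtration ℕ mΩ}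

/-- Induction on `k`: the arrival on slot `t + k` is independent of `ℱ (t + k)`, which contains `S`
and the partial sum so far. The second moment is that of a binomial variable, because arrivals are 0
or 1 and equal their squares. -/
theorem setIntegral_slotArrivals (hA : ∀ t, Measurable[ℱ (t + 1)] (A t))
    (hle : ∀ t ω m, A t ω m ≤ 1) (hmean : ∀ t m, ∫ ω, (A t ω m : ℝ) ∂P = lam m)
    (hind : ∀ t, Indep (ℱ t) (MeasurableSpace.comap (A t) inferInstance) P)
    (t : ℕ) (m : Fin M) {S : Set Ω} (hS : MeasurableSet[ℱ t] S) (k : ℕ) :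
    ∫ ω in S, ((∑ τ ∈ Finset.Ico t (t + k), A τ ω m : ℕ) : ℝ) ∂P = P.real S * (k * lam m) ∧
    ∫ ω in S, ((∑ τ ∈ Finset.Ico t (t + k), A τ ω m : ℕ) : ℝ) ^ 2 ∂P =
      P.real S * (k * lam m + k * (k - 1) * lam m ^ 2) := by
  have hSm : MeasurableSet S := ℱ.le t _ hS
  have hWm : ∀ k, Measurable[ℱ (t + k)]
      fun ω => ((∑ τ ∈ Finset.Ico t (t + k), A τ ω m : ℕ) : ℝ) := by
    intro k
    refine measurable_from_nat.comp (Finset.measurable_fun_sum _ fun τ hτ => ?_)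
    have hlt : τ + 1 ≤ t + k := (Finset.mem_Ico.1 hτ).2
    exact (measurable_pi_apply m).comp ((hA τ).mono (ℱ.mono hlt) le_rfl)
  have hWb : ∀ k ω, |((∑ τ ∈ Finset.Ico t (t + k), A τ ω m : ℕ) : ℝ)| ≤ k := by
    intro k ω
    rw [abs_of_nonneg (Nat.cast_nonneg _)]
    have := Finset.sum_le_card_nsmul (Finset.Ico t (t + k)) (fun τ => A τ ω m) 1
      fun τ _ => hle τ ω m
    simp only [Nat.card_Ico, add_tsub_cancel_left, smul_eq_mul, mul_one] at this
    exact_mod_cast this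
  have hAm : ∀ τ, Measurable (A τ) := fun τ => (hA τ).mono (ℱ.le _) le_rfl
  have hAm' : ∀ τ, Measurable fun ω => (A τ ω m : ℝ) := fun τ =>
    measurable_from_nat.comp ((measurable_pi_apply m).comp (hAm τ))
  have hAb : ∀ τ ω, |(A τ ω m : ℝ)| ≤ 1 := fun τ ω => by
    rw [abs_of_nonneg (Nat.cast_nonneg _)]; exact_mod_cast hle τ ω m
  have hAsq : ∀ τ ω, (A τ ω m : ℝ) ^ 2 = A τ ω m := fun τ ω => by
    have := hle τ ω m
    interval_cases A τ ω m <;> simp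
  have hAint : ∀ k, ∀ {Z : Ω → ℝ}, Measurable[ℱ (t + k)] Z →
      ∫ ω in S, Z ω * (A (t + k) ω m : ℝ) ∂P = (∫ ω in S, Z ω ∂P) * lam m := by
    intro k Z hZ
    have hS' : MeasurableSet[ℱ (t + k)] S := ℱ.mono (Nat.le_add_right t k) _ hS
    have := integral_mul_arrival (ℱ.le (t + k)) (hZ.indicator hS') (hAm (t + k)) (hind (t + k)) m
    rw [hmean, integral_indicator hSm] at this
    rw [← this, ← integral_indicator hSm]
    congr 1
    ext ω
    by_cases hω : ω ∈ S <;> simp [hω]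
  have hWi : ∀ k, Integrable
      (fun ω => ((∑ τ ∈ Finset.Ico t (t + k), A τ ω m : ℕ) : ℝ)) (P.restrict S) := fun k =>
    (integrable_of_abs_le ((hWm k).mono (ℱ.le _) le_rfl) (hWb k)).integrableOn
  have hWsq : ∀ k, Integrable
      (fun ω => ((∑ τ ∈ Finset.Ico t (t + k), A τ ω m : ℕ) : ℝ) ^ 2) (P.restrict S) := fun k =>
    (integrable_of_abs_le (((hWm k).mono (ℱ.le _) le_rfl).pow_const 2) (b := (k : ℝ) ^ 2)
      fun ω => by
        rw [abs_pow]; exact pow_le_pow_left₀ (abs_nonneg _) (hWb k ω) 2).integrableOn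
  have hAi : ∀ τ, Integrable (fun ω => (A τ ω m : ℝ)) (P.restrict S) := fun τ =>
    (integrable_of_abs_le (hAm' τ) (hAb τ)).integrableOn
  have hWA : ∀ k, Integrable (fun ω => 2 * (((∑ τ ∈ Finset.Ico t (t + k), A τ ω m : ℕ) : ℝ) *
      (A (t + k) ω m : ℝ))) (P.restrict S) := fun k =>
    ((integrable_of_abs_le (((hWm k).mono (ℱ.le _) le_rfl).mul (hAm' (t + k))) (b := (k : ℝ) * 1)
      fun ω => by
        rw [Pi.mul_apply, abs_mul]
        exact mul_le_mul (hWb k ω) (hAb _ ω) (abs_nonneg _)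
          (Nat.cast_nonneg k)).const_mul 2).integrableOn
  have hone : ∀ k, ∫ ω in S, (A (t + k) ω m : ℝ) ∂P = P.real S * lam m := fun k => by
    have := hAint k (Z := fun _ => 1) measurable_const
    simpa using this
  have hsucc : ∀ k ω, ((∑ τ ∈ Finset.Ico t (t + (k + 1)), A τ ω m : ℕ) : ℝ) =
      ((∑ τ ∈ Finset.Ico t (t + k), A τ ω m : ℕ) : ℝ) + A (t + k) ω m := fun k ω => by
    rw [← add_assoc, Finset.sum_Ico_succ_top (Nat.le_add_right t k), Nat.cast_add]
  have hsq : ∀ k ω, ((∑ τ ∈ Finset.Ico t (t + (k + 1)), A τ ω m : ℕ) : ℝ) ^ 2 =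
      ((∑ τ ∈ Finset.Ico t (t + k), A τ ω m : ℕ) : ℝ) ^ 2 +
        2 * (((∑ τ ∈ Finset.Ico t (t + k), A τ ω m : ℕ) : ℝ) * A (t + k) ω m) +
        A (t + k) ω m := fun k ω => by
    rw [hsucc, add_sq, hAsq]; ring
  induction k with
  | zero => simp
  | succ k ih =>
    refine ⟨?_, ?_⟩
    · simp_rw [hsucc]
      rw [integral_add (hWi k) (hAi (t + k)), ih.1, hone]
      push_cast
      ring
    · simp_rw [hsq]
      have hadd : Integrable (fun ω => ((∑ τ ∈ Finset.Ico t (t + k), A τ ω m : ℕ) : ℝ) ^ 2 +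
          2 * (((∑ τ ∈ Finset.Ico t (t + k), A τ ω m : ℕ) : ℝ) * A (t + k) ω m)) (P.restrict S) :=
        (hWsq k).add (hWA k)
      rw [integral_add hadd (hAi (t + k)), integral_add (hWsq k) (hWA k), ih.2, hone,
        integral_const_mul, hAint k (hWm k), ih.1]
      push_cast
      ring

variable {T : 𝒜 → ℕ} {α : ℕ → Ω → 𝒜}
  (h : ∀ r t a, MeasurableSet[ℱ t] {ω | frameStart T (fun s => α s ω) r = t ∧ α r ω = a})

/-- A functional of the arrivals on `k` consecutive slots whose mean, given the past, is `g k` has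
conditional mean `g (T (α r))` on frame `r`. -/
theorem condExp_frameArrivals (hA : ∀ t, Measurable[ℱ (t + 1)] (A t))
    (hle : ∀ t ω m, A t ω m ≤ 1) {K : ℕ} (hK : ∀ a, T a ≤ K) (m : Fin M) (φ g : ℕ → ℝ)
    (hφ : ∀ t k S, MeasurableSet[ℱ t] S →
      ∫ ω in S, φ (∑ τ ∈ Finset.Ico t (t + k), A τ ω m) ∂P = P.real S * g k) (r : ℕ) :
    P[fun ω => φ (arrivals T A α r ω m) | frameInfo ℱ T α h r] =ᵐ[P] fun ω => g (T (α r ω)) := by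
  have hφb : ∀ ω, |φ (arrivals T A α r ω m)| ≤ ∑ j ∈ Finset.range (K + 1), |φ j| := fun ω =>
    Finset.single_le_sum (f := fun j => |φ j|) (fun _ _ => abs_nonneg _)
      (Finset.mem_range.2 (Nat.lt_succ_of_le
        ((frameArrivals_le T (fun s => α s ω) (fun t m => hle t ω m) r m).trans (hK _))))
  have hφm : Measurable fun ω => φ (arrivals T A α r ω m) :=
    measurable_from_nat.comp ((measurable_pi_apply m).comp
      ((measurable_arrivals h hA r).mono ((frameInfo ℱ T α h).le _) le_rfl))
  have hφi : Integrable (fun ω => φ (arrivals T A α r ω m)) P := integrable_of_abs_le hφm hφb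
  have hgm : Measurable[frameInfo ℱ T α h r] fun ω => g (T (α r ω)) :=
    (@measurable_from_top 𝒜 ℝ _ fun a => g (T a)).comp (measurable_action h r)
  have hgi : Integrable (fun ω => g (T (α r ω))) P :=
    integrable_of_abs_le (hgm.mono ((frameInfo ℱ T α h).le r) le_rfl)
      (b := ∑ a, |g (T a)|) fun ω =>
        Finset.single_le_sum (f := fun a => |g (T a)|) (fun _ _ => abs_nonneg _)
          (Finset.mem_univ (α r ω))
  refine (ae_eq_condExp_of_forall_setIntegral_eq ((frameInfo ℱ T α h).le r) hφi
    (fun _ _ _ => hgi.integrableOn) (fun S hS _ => ?_)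
    hgm.stronglyMeasurable.aestronglyMeasurable).symm
  -- Splitting by start slot and action gives countably many pieces, each known at its own start
  -- slot, on which the frame is a fixed window.
  set E : ℕ × 𝒜 → Set Ω := fun q =>
    S ∩ {ω | frameStart T (fun s => α s ω) r = q.1 ∧ α r ω = q.2} with hE
  have hSE : S = ⋃ q, E q := by
    ext ω; simp [hE]
  have hEF : ∀ q, MeasurableSet[ℱ q.1] (E q) := fun q =>
    measurableSet_frameInfo_inter h hS q.1 q.2
  have hEm : ∀ q, MeasurableSet (E q) := fun q => ℱ.le _ _ (hEF q)
  have hdisj : Pairwise (Function.onFun Disjoint E) := by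
    intro q q' hqq
    refine Set.disjoint_left.2 fun ω hω hω' => hqq ?_
    exact Prod.ext (hω.2.1.symm.trans hω'.2.1) (hω.2.2.symm.trans hω'.2.2)
  rw [hSE, integral_iUnion hEm hdisj hgi.integrableOn, integral_iUnion hEm hdisj hφi.integrableOn]
  refine tsum_congr fun q => ?_
  have h1 : ∫ ω in E q, g (T (α r ω)) ∂P = ∫ _ in E q, g (T q.2) ∂P :=
    setIntegral_congr_fun (hEm q) fun ω hω => by
      rw [hω.2.2]
  have h2 : ∫ ω in E q, φ (arrivals T A α r ω m) ∂P =
      ∫ ω in E q, φ (∑ τ ∈ Finset.Ico q.1 (q.1 + T q.2), A τ ω m) ∂P :=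
    setIntegral_congr_fun (hEm q) fun ω hω => by
      change φ (∑ τ ∈ Finset.Ico (frameStart T (fun s => α s ω) r)
        (frameStart T (fun s => α s ω) r + T (α r ω)), A τ ω m) = _
      rw [hω.2.1, hω.2.2]
  rw [h1, h2, hφ _ _ _ (hEF q)]
  simp

end Moments

/-! ### The quadratic Lyapunov function -/

section Lyapunov

variable {M : ℕ} {𝒜 : Type*} {Ω : Type*} (T : 𝒜 → ℕ) (μ : 𝒜 → Fin M → ℕ)
  (lam : Fin M → ℝ) (A : ℕ → Ω → Fin M → ℕ) (α : ℕ → Ω → 𝒜)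

/-- `(1/2) ∑ m, Q_m[r] ^ 2`. -/
noncomputable def lyapunov (r : ℕ) (ω : Ω) : ℝ := (1 / 2) * ∑ m, (queue T μ A α r ω m : ℝ) ^ 2

/-- `∑ m, Q_m[r] (a_m[r] - λ_m T(α[r]))`. -/
noncomputable def driftNoise (r : ℕ) (ω : Ω) : ℝ :=
  ∑ m, (queue T μ A α r ω m : ℝ) * ((arrivals T A α r ω m : ℝ) - lam m * T (α r ω))

/-- `∑ m, Q_m[r] (μ_m(α[r]) - λ_m T(α[r]))`. -/
noncomputable def driftGain (r : ℕ) (ω : Ω) : ℝ :=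
  ∑ m, (queue T μ A α r ω m : ℝ) * ((μ (α r ω) m : ℝ) - lam m * T (α r ω))

/-- The total backlog. -/
noncomputable def totalQueue (r : ℕ) (ω : Ω) : ℝ := ∑ m, (queue T μ A α r ω m : ℝ)

theorem lyapunov_zero (ω : Ω) : lyapunov T μ A α 0 ω = 0 := by
  simp [lyapunov, queue, backlog]

theorem lyapunov_nonneg (r : ℕ) (ω : Ω) : 0 ≤ lyapunov T μ A α r ω :=
  mul_nonneg (by norm_num) (Finset.sum_nonneg fun _ _ => sq_nonneg _)

theorem totalQueue_nonneg (r : ℕ) (ω : Ω) : 0 ≤ totalQueue T μ A α r ω :=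
  Finset.sum_nonneg fun _ _ => Nat.cast_nonneg _

theorem lyapunov_succ_le (r : ℕ) (ω : Ω) :
    lyapunov T μ A α (r + 1) ω ≤ lyapunov T μ A α r ω +
      (halfSquares T μ A α r ω + driftNoise T μ lam A α r ω - driftGain T μ lam A α r ω) := by
  unfold lyapunov halfSquares driftNoise driftGain
  rw [add_sub_assoc, ← Finset.sum_sub_distrib, Finset.mul_sum, Finset.mul_sum, Finset.mul_sum,
    ← Finset.sum_add_distrib, ← Finset.sum_add_distrib]
  refine Finset.sum_le_sum fun m _ => ?_
  have h := sq_queue_step_le (queue T μ A α r ω m) (μ (α r ω) m) (arrivals T A α r ω m)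
  have h2 : queue T μ A α (r + 1) ω m =
    queue T μ A α r ω m - μ (α r ω) m + arrivals T A α r ω m := rfl
  rw [h2]
  linarith

theorem lyapunov_le_totalQueue_sq (r : ℕ) (ω : Ω) :
    lyapunov T μ A α r ω ≤ totalQueue T μ A α r ω ^ 2 / 2 := by
  have h := Finset.sum_sq_le_sq_sum_of_nonneg (s := Finset.univ)
    (f := fun m => (queue T μ A α r ω m : ℝ)) fun _ _ => Nat.cast_nonneg _
  unfold lyapunov totalQueue
  linarith

/-- Cauchy–Schwarz over the flows. The factor `M + 1` instead of `M` keeps the constant positive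
when there are no flows. -/
theorem totalQueue_sq_le_lyapunov (r : ℕ) (ω : Ω) :
    totalQueue T μ A α r ω ^ 2 ≤ 2 * (M + 1) * lyapunov T μ A α r ω := by
  have h := sq_sum_le_card_mul_sum_sq (s := Finset.univ)
    (f := fun m => (queue T μ A α r ω m : ℝ))
  have h0 : 0 ≤ ∑ m, (queue T μ A α r ω m : ℝ) ^ 2 := Finset.sum_nonneg fun _ _ => sq_nonneg _
  simp only [Finset.card_univ, Fintype.card_fin] at h
  unfold lyapunov totalQueue
  linarith

end Lyapunov

/-- A system run by a causal algorithm with information flow `ℱ`, whose frame sizes and clearances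
are at most `K`. -/
structure FrameSystem {M : ℕ} {𝒜 : Type*} {Ω : Type*} {mΩ : MeasurableSpace Ω} (P : Measure Ω)
    (T : 𝒜 → ℕ) (μ : 𝒜 → Fin M → ℕ) (lam : Fin M → ℝ) (A : ℕ → Ω → Fin M → ℕ) (α : ℕ → Ω → 𝒜)
    (ℱ : Filtration ℕ mΩ) (K : ℕ) : Prop where
  decided : ∀ r t a, MeasurableSet[ℱ t] {ω | frameStart T (fun s => α s ω) r = t ∧ α r ω = a}
  adapted : ∀ t, Measurable[ℱ (t + 1)] (A t)
  indep : ∀ t, Indep (ℱ t) (MeasurableSpace.comap (A t) inferInstance) P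
  le_one : ∀ t ω m, A t ω m ≤ 1
  mean : ∀ t m, ∫ ω, (A t ω m : ℝ) ∂P = lam m
  frame_le : ∀ a, T a ≤ K
  clear_le : ∀ a m, μ a m ≤ K

theorem IsSystem.exists_frameSystem {M : ℕ} {𝒜 : Type*} {Ω : Type*} [mΩ : MeasurableSpace Ω]
    {P : Measure Ω} {T : 𝒜 → ℕ} {μ : 𝒜 → Fin M → ℕ} {lam : Fin M → ℝ} {A : ℕ → Ω → Fin M → ℕ}
    {α : ℕ → Ω → 𝒜} (h : IsSystem P T lam A α) {K : ℕ} (hT : ∀ a, T a ≤ K)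
    (hμ : ∀ a m, μ a m ≤ K) : ∃ ℱ : Filtration ℕ mΩ, FrameSystem P T μ lam A α ℱ K := by
  obtain ⟨ℱ, h1, h2, h3⟩ := h.causal
  exact ⟨ℱ, h3, h1, h2, h.arrivals_le_one, h.arrivals_iid.mean, hT, hμ⟩

namespace FrameSystem

set_option linter.unusedSectionVars false

variable {M : ℕ} {𝒜 : Type*} [Fintype 𝒜] {Ω : Type*} {mΩ : MeasurableSpace Ω} {P : Measure Ω}
  [IsProbabilityMeasure P] {T : 𝒜 → ℕ} {μ : 𝒜 → Fin M → ℕ} {lam : Fin M → ℝ}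
  {A : ℕ → Ω → Fin M → ℕ} {α : ℕ → Ω → 𝒜} {ℱ : Filtration ℕ mΩ} {K : ℕ}

/-! ### Measurability at frame starts -/

theorem measurable_arrival_real {m' : MeasurableSpace Ω} {r : ℕ}
    (h : Measurable[m'] (arrivals T A α r)) (m : Fin M) :
    Measurable[m'] fun ω => (arrivals T A α r ω m : ℝ) :=
  measurable_from_nat.comp ((measurable_pi_apply m).comp h)

theorem measurable_queue_frameInfo (S : FrameSystem P T μ lam A α ℱ K) (r : ℕ) :
    Measurable[frameInfo ℱ T α S.decided r] (queue T μ A α r) :=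
  measurable_queue μ (fun r => frameInfo ℱ T α S.decided r)
    (fun _ _ hrs => (frameInfo ℱ T α S.decided).mono hrs)
    (fun r => (measurable_action S.decided r).mono
      ((frameInfo ℱ T α S.decided).mono (Nat.le_succ r)) le_rfl)
    (measurable_arrivals S.decided S.adapted) r

theorem measurable_queue_real (S : FrameSystem P T μ lam A α ℱ K) (r : ℕ) (m : Fin M) :
    Measurable[frameInfo ℱ T α S.decided r] fun ω => (queue T μ A α r ω m : ℝ) :=
  measurable_from_nat.comp ((measurable_pi_apply m).comp (S.measurable_queue_frameInfo r))

theorem measurable_of_action (S : FrameSystem P T μ lam A α ℱ K) (r : ℕ) (f : 𝒜 → ℝ) :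
    Measurable[frameInfo ℱ T α S.decided r] fun ω => f (α r ω) :=
  (@measurable_from_top 𝒜 ℝ _ f).comp (measurable_action S.decided r)

theorem measurable_lyapunov (S : FrameSystem P T μ lam A α ℱ K) (r : ℕ) :
    Measurable[frameInfo ℱ T α S.decided r] (lyapunov T μ A α r) :=
  (Finset.measurable_fun_sum _ fun m _ => (S.measurable_queue_real r m).pow_const 2).const_mul _

theorem measurable_driftNoise (S : FrameSystem P T μ lam A α ℱ K) (r : ℕ) :
    Measurable[frameInfo ℱ T α S.decided (r + 1)] (driftNoise T μ lam A α r) :=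
  Finset.measurable_fun_sum _ fun m _ =>
    ((S.measurable_queue_real r m).mono ((frameInfo ℱ T α S.decided).mono (Nat.le_succ r))
      le_rfl).mul ((measurable_arrival_real (measurable_arrivals S.decided S.adapted r) m).sub
        ((S.measurable_of_action r fun a => lam m * T a).mono
          ((frameInfo ℱ T α S.decided).mono (Nat.le_succ r)) le_rfl))

theorem measurable_halfSquares_historyInfo (T : 𝒜 → ℕ) (μ : 𝒜 → Fin M → ℕ)
    (A : ℕ → Ω → Fin M → ℕ) (α : ℕ → Ω → 𝒜) (r : ℕ) :
    Measurable[historyInfo T A α (r + 1)] (halfSquares T μ A α r) :=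
  (Finset.measurable_fun_sum _ fun m _ =>
    ((measurable_arrival_real (measurable_arrivals_historyInfo T A α r) m).pow_const 2).add
      ((@measurable_from_top 𝒜 ℝ _ fun a => (μ a m : ℝ) ^ 2).comp
        (measurable_action_historyInfo T A α r))).const_mul _

theorem historyInfo_le (S : FrameSystem P T μ lam A α ℱ K) (r : ℕ) : historyInfo T A α r ≤ mΩ :=
  (historyInfo_le_frameInfo S.decided S.adapted r).trans ((frameInfo ℱ T α S.decided).le r)

theorem backlogInfo_le_frameInfo (S : FrameSystem P T μ lam A α ℱ K) (r : ℕ) :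
    backlogInfo T μ A α r ≤ frameInfo ℱ T α S.decided r :=
  (S.measurable_queue_frameInfo r).comap_le

theorem measurable_halfSquares (S : FrameSystem P T μ lam A α ℱ K) (r : ℕ) :
    Measurable (halfSquares T μ A α r) :=
  (measurable_halfSquares_historyInfo T μ A α r).mono (S.historyInfo_le (r + 1)) le_rfl

/-! ### Deterministic bounds and integrability -/

theorem lam_nonneg (S : FrameSystem P T μ lam A α ℱ K) (m : Fin M) : 0 ≤ lam m := by
  rw [← S.mean 0 m]; exact integral_nonneg fun _ => Nat.cast_nonneg _

theorem measurable_arrivals_slot (S : FrameSystem P T μ lam A α ℱ K) (t : ℕ) (m : Fin M) :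
    Measurable fun ω => (A t ω m : ℝ) :=
  measurable_from_nat.comp ((measurable_pi_apply m).comp
    ((S.adapted t).mono (ℱ.le (t + 1)) le_rfl))

theorem integrable_arrivals_slot (S : FrameSystem P T μ lam A α ℱ K) (t : ℕ) (m : Fin M) :
    Integrable (fun ω => (A t ω m : ℝ)) P :=
  integrable_of_abs_le (S.measurable_arrivals_slot t m) (b := 1) fun ω => by
    rw [abs_of_nonneg (Nat.cast_nonneg _)]; exact_mod_cast S.le_one t ω m

theorem lam_le_one (S : FrameSystem P T μ lam A α ℱ K) (m : Fin M) : lam m ≤ 1 := by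
  rw [← S.mean 0 m]
  calc ∫ ω, (A 0 ω m : ℝ) ∂P ≤ ∫ _, (1 : ℝ) ∂P :=
        integral_mono (S.integrable_arrivals_slot 0 m) (integrable_const 1) fun ω =>
          Nat.cast_le_one.2 (S.le_one 0 ω m)
    _ = 1 := by simp

theorem arrivals_le (S : FrameSystem P T μ lam A α ℱ K) (r : ℕ) (ω : Ω) (m : Fin M) :
    arrivals T A α r ω m ≤ K :=
  (frameArrivals_le T (fun s => α s ω) (fun t m => S.le_one t ω m) r m).trans (S.frame_le _)

theorem queue_le (S : FrameSystem P T μ lam A α ℱ K) (r : ℕ) (ω : Ω) (m : Fin M) :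
    queue T μ A α r ω m ≤ r * K :=
  backlog_le T μ S.frame_le (fun s => α s ω) (fun t m => S.le_one t ω m) r m

theorem lam_mul_frame_le (S : FrameSystem P T μ lam A α ℱ K) (a : 𝒜) (m : Fin M) :
    lam m * T a ≤ K :=
  (mul_le_of_le_one_left (Nat.cast_nonneg _) (S.lam_le_one m)).trans
    (by exact_mod_cast S.frame_le a)

theorem lam_mul_frame_nonneg (S : FrameSystem P T μ lam A α ℱ K) (a : 𝒜) (m : Fin M) :
    0 ≤ lam m * T a :=
  mul_nonneg (S.lam_nonneg m) (Nat.cast_nonneg _)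

theorem totalQueue_le (S : FrameSystem P T μ lam A α ℱ K) (r : ℕ) (ω : Ω) :
    totalQueue T μ A α r ω ≤ M * (r * K) := by
  have : totalQueue T μ A α r ω ≤ ∑ _m : Fin M, ((r : ℝ) * K) :=
    Finset.sum_le_sum fun m _ => by exact_mod_cast S.queue_le r ω m
  simpa using this

theorem abs_driftNoise_le (S : FrameSystem P T μ lam A α ℱ K) (r : ℕ) (ω : Ω) :
    |driftNoise T μ lam A α r ω| ≤ K * totalQueue T μ A α r ω := by
  unfold driftNoise totalQueue
  rw [Finset.mul_sum]
  refine (Finset.abs_sum_le_sum_abs _ _).trans (Finset.sum_le_sum fun m _ => ?_)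
  rw [abs_mul, abs_of_nonneg (Nat.cast_nonneg (queue T μ A α r ω m)), mul_comm]
  refine mul_le_mul_of_nonneg_right ?_ (Nat.cast_nonneg _)
  have h1 : (arrivals T A α r ω m : ℝ) ≤ K := by exact_mod_cast S.arrivals_le r ω m
  have h2 : (0 : ℝ) ≤ arrivals T A α r ω m := Nat.cast_nonneg _
  have h3 := S.lam_mul_frame_le (α r ω) m
  have h4 := S.lam_mul_frame_nonneg (α r ω) m
  rw [abs_le]
  constructor <;> linarith

theorem abs_driftGain_le (S : FrameSystem P T μ lam A α ℱ K) (r : ℕ) (ω : Ω) :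
    |driftGain T μ lam A α r ω| ≤ K * totalQueue T μ A α r ω := by
  unfold driftGain totalQueue
  rw [Finset.mul_sum]
  refine (Finset.abs_sum_le_sum_abs _ _).trans (Finset.sum_le_sum fun m _ => ?_)
  rw [abs_mul, abs_of_nonneg (Nat.cast_nonneg (queue T μ A α r ω m)), mul_comm]
  refine mul_le_mul_of_nonneg_right ?_ (Nat.cast_nonneg _)
  have h1 : (μ (α r ω) m : ℝ) ≤ K := by exact_mod_cast S.clear_le (α r ω) m
  have h2 : (0 : ℝ) ≤ μ (α r ω) m := Nat.cast_nonneg _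
  have h3 := S.lam_mul_frame_le (α r ω) m
  have h4 := S.lam_mul_frame_nonneg (α r ω) m
  rw [abs_le]
  constructor <;> linarith

theorem halfSquares_nonneg (T : 𝒜 → ℕ) (μ : 𝒜 → Fin M → ℕ) (A : ℕ → Ω → Fin M → ℕ)
    (α : ℕ → Ω → 𝒜) (r : ℕ) (ω : Ω) : 0 ≤ halfSquares T μ A α r ω :=
  mul_nonneg (by norm_num) (Finset.sum_nonneg fun _ _ => by positivity)

theorem halfSquares_le (S : FrameSystem P T μ lam A α ℱ K) (r : ℕ) (ω : Ω) :
    halfSquares T μ A α r ω ≤ M * (K : ℝ) ^ 2 := by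
  have h : ∑ m, ((arrivals T A α r ω m : ℝ) ^ 2 + (μ (α r ω) m : ℝ) ^ 2) ≤
      ∑ _m : Fin M, ((K : ℝ) ^ 2 + (K : ℝ) ^ 2) := Finset.sum_le_sum fun m _ => by
    have h1 : (arrivals T A α r ω m : ℝ) ≤ K := by exact_mod_cast S.arrivals_le r ω m
    have h2 : (μ (α r ω) m : ℝ) ≤ K := by exact_mod_cast S.clear_le (α r ω) m
    gcongr
  simp only [Finset.sum_const, Finset.card_univ, Fintype.card_fin, nsmul_eq_mul] at h
  unfold halfSquares
  linarith

theorem abs_halfSquares_le (S : FrameSystem P T μ lam A α ℱ K) (r : ℕ) (ω : Ω) :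
    |halfSquares T μ A α r ω| ≤ M * (K : ℝ) ^ 2 := by
  rw [abs_of_nonneg (halfSquares_nonneg T μ A α r ω)]; exact S.halfSquares_le r ω

theorem lyapunov_le (S : FrameSystem P T μ lam A α ℱ K) (r : ℕ) (ω : Ω) :
    lyapunov T μ A α r ω ≤ (M * (r * K)) ^ 2 / 2 := by
  refine (lyapunov_le_totalQueue_sq T μ A α r ω).trans ?_
  have := S.totalQueue_le r ω
  have := totalQueue_nonneg T μ A α r ω
  gcongr

theorem integrable_queue (S : FrameSystem P T μ lam A α ℱ K) (r : ℕ) (m : Fin M) :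
    Integrable (fun ω => (queue T μ A α r ω m : ℝ)) P :=
  integrable_of_abs_le ((S.measurable_queue_real r m).mono ((frameInfo ℱ T α S.decided).le r) le_rfl)
    (b := r * K) fun ω => by
      rw [abs_of_nonneg (Nat.cast_nonneg _)]; exact_mod_cast S.queue_le r ω m

theorem integrable_halfSquares (S : FrameSystem P T μ lam A α ℱ K) (r : ℕ) :
    Integrable (halfSquares T μ A α r) P :=
  integrable_of_abs_le (S.measurable_halfSquares r) (S.abs_halfSquares_le r)

theorem integrable_driftNoise (S : FrameSystem P T μ lam A α ℱ K) (r : ℕ) :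
    Integrable (driftNoise T μ lam A α r) P :=
  integrable_of_abs_le ((S.measurable_driftNoise r).mono ((frameInfo ℱ T α S.decided).le _) le_rfl)
    (b := K * (M * (r * K))) fun ω => (S.abs_driftNoise_le r ω).trans
      (mul_le_mul_of_nonneg_left (S.totalQueue_le r ω) (Nat.cast_nonneg K))

theorem abs_lyapunov_le (S : FrameSystem P T μ lam A α ℱ K) (r : ℕ) (ω : Ω) :
    |lyapunov T μ A α r ω| ≤ (M * (r * K)) ^ 2 / 2 := by
  rw [abs_of_nonneg (lyapunov_nonneg T μ A α r ω)]; exact S.lyapunov_le r ω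

theorem measurable_lyapunov_ambient (S : FrameSystem P T μ lam A α ℱ K) (r : ℕ) :
    Measurable (lyapunov T μ A α r) :=
  (S.measurable_lyapunov r).mono ((frameInfo ℱ T α S.decided).le _) le_rfl

theorem integrable_lyapunov (S : FrameSystem P T μ lam A α ℱ K) (r : ℕ) :
    Integrable (lyapunov T μ A α r) P :=
  integrable_of_abs_le (S.measurable_lyapunov_ambient r) (S.abs_lyapunov_le r)

theorem integrable_lyapunov_sq (S : FrameSystem P T μ lam A α ℱ K) (r : ℕ) :
    Integrable (fun ω => lyapunov T μ A α r ω ^ 2) P :=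
  integrable_of_abs_le ((S.measurable_lyapunov_ambient r).pow_const 2)
    (b := ((M * (r * K)) ^ 2 / 2) ^ 2) fun ω => by
      rw [abs_pow]; exact pow_le_pow_left₀ (abs_nonneg _) (S.abs_lyapunov_le r ω) 2

/-! ### Conditional means of the drift terms -/

theorem condExp_arrivals (S : FrameSystem P T μ lam A α ℱ K) (r : ℕ) (m : Fin M) :
    P[fun ω => (arrivals T A α r ω m : ℝ) | frameInfo ℱ T α S.decided r] =ᵐ[P]
      fun ω => T (α r ω) * lam m :=
  condExp_frameArrivals S.decided S.adapted S.le_one S.frame_le m (fun n => (n : ℝ))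
    (fun k => k * lam m)
    (fun t k _ hE => (setIntegral_slotArrivals S.adapted S.le_one S.mean S.indep t m hE k).1) r

theorem condExp_arrivals_sq (S : FrameSystem P T μ lam A α ℱ K) (r : ℕ) (m : Fin M) :
    P[fun ω => (arrivals T A α r ω m : ℝ) ^ 2 | frameInfo ℱ T α S.decided r] =ᵐ[P]
      fun ω => T (α r ω) * lam m + T (α r ω) * (T (α r ω) - 1) * lam m ^ 2 :=
  condExp_frameArrivals S.decided S.adapted S.le_one S.frame_le m (fun n => (n : ℝ) ^ 2)
    (fun k => k * lam m + k * (k - 1) * lam m ^ 2)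
    (fun t k _ hE => (setIntegral_slotArrivals S.adapted S.le_one S.mean S.indep t m hE k).2) r

theorem integrable_of_action (S : FrameSystem P T μ lam A α ℱ K) (r : ℕ) (f : 𝒜 → ℝ) :
    Integrable (fun ω => f (α r ω)) P :=
  integrable_of_abs_le ((S.measurable_of_action r f).mono ((frameInfo ℱ T α S.decided).le r) le_rfl)
    (b := ∑ a, |f a|) fun ω => Finset.single_le_sum (f := fun a => |f a|)
      (fun _ _ => abs_nonneg _) (Finset.mem_univ (α r ω))

theorem integrable_arrivals (S : FrameSystem P T μ lam A α ℱ K) (r : ℕ) (m : Fin M) :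
    Integrable (fun ω => (arrivals T A α r ω m : ℝ)) P :=
  integrable_of_abs_le (measurable_arrival_real ((measurable_arrivals S.decided S.adapted r).mono
    ((frameInfo ℱ T α S.decided).le _) le_rfl) m) (b := K) fun ω => by
      rw [abs_of_nonneg (Nat.cast_nonneg _)]; exact_mod_cast S.arrivals_le r ω m

theorem integrable_arrivals_sq (S : FrameSystem P T μ lam A α ℱ K) (r : ℕ) (m : Fin M) :
    Integrable (fun ω => (arrivals T A α r ω m : ℝ) ^ 2) P :=
  integrable_of_abs_le ((measurable_arrival_real ((measurable_arrivals S.decided S.adapted r).mono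
    ((frameInfo ℱ T α S.decided).le _) le_rfl) m).pow_const 2) (b := (K : ℝ) ^ 2) fun ω => by
      rw [abs_of_nonneg (sq_nonneg _)]
      have : (arrivals T A α r ω m : ℝ) ≤ K := by exact_mod_cast S.arrivals_le r ω m
      gcongr

/-- The backlog is known at the start of the frame and factors out; what remains is centred, since
the expected arrivals are λ_m times the frame size. -/
theorem condExp_driftNoise (S : FrameSystem P T μ lam A α ℱ K) (r : ℕ) :
    P[driftNoise T μ lam A α r | frameInfo ℱ T α S.decided r] =ᵐ[P] 0 := by
  have hle := (frameInfo ℱ T α S.decided).le r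
  have hc : ∀ m, Integrable (fun ω => (arrivals T A α r ω m : ℝ) - lam m * T (α r ω)) P := fun m =>
    (S.integrable_arrivals r m).sub (S.integrable_of_action r fun a => lam m * T a)
  have hp : ∀ m, Integrable ((fun ω => (queue T μ A α r ω m : ℝ)) *
      fun ω => (arrivals T A α r ω m : ℝ) - lam m * T (α r ω)) P := fun m =>
    (hc m).bdd_mul (c := r * K)
      ((S.measurable_queue_real r m).mono hle le_rfl).aestronglyMeasurable (ae_of_all _ fun ω => by
        rw [Real.norm_of_nonneg (Nat.cast_nonneg _)]; exact_mod_cast S.queue_le r ω m)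
  have hterm : ∀ m, P[(fun ω => (queue T μ A α r ω m : ℝ)) *
      (fun ω => (arrivals T A α r ω m : ℝ) - lam m * T (α r ω)) |
        frameInfo ℱ T α S.decided r] =ᵐ[P] 0 := fun m => by
    have h1 := condExp_sub (S.integrable_arrivals r m)
      (S.integrable_of_action r fun a => lam m * T a) (frameInfo ℱ T α S.decided r)
    have h2 := condExp_of_stronglyMeasurable hle
      (S.measurable_of_action r fun a => lam m * T a).stronglyMeasurable
      (S.integrable_of_action r fun a => lam m * T a)
    filter_upwards [condExp_mul_of_stronglyMeasurable_left
      (S.measurable_queue_real r m).stronglyMeasurable (hp m) (hc m), h1,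
      S.condExp_arrivals r m] with ω h3 h4 h5
    have h6 : P[fun ω => (arrivals T A α r ω m : ℝ) - lam m * T (α r ω) |
        frameInfo ℱ T α S.decided r] ω = 0 := by
      refine Eq.trans h4 ?_
      rw [Pi.sub_apply, h5, h2]
      ring
    rw [h3, Pi.mul_apply, h6]
    simp
  have hsum : driftNoise T μ lam A α r = ∑ m, ((fun ω => (queue T μ A α r ω m : ℝ)) *
      fun ω => (arrivals T A α r ω m : ℝ) - lam m * T (α r ω)) := by
    ext ω; simp [driftNoise]
  rw [hsum]
  filter_upwards [condExp_finsetSum (s := Finset.univ) (fun m _ => hp m)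
    (frameInfo ℱ T α S.decided r), ae_all_iff.2 hterm] with ω h1 h2
  rw [h1, Finset.sum_apply]
  exact Finset.sum_eq_zero fun m _ => h2 m

/-- The conditional mean of `halfSquares` given the start of the frame is a function of the
action. -/
theorem exists_condExp_halfSquares (S : FrameSystem P T μ lam A α ℱ K) (r : ℕ) :
    ∃ f : 𝒜 → ℝ, P[halfSquares T μ A α r | frameInfo ℱ T α S.decided r] =ᵐ[P]
      fun ω => f (α r ω) := by
  have hle := (frameInfo ℱ T α S.decided).le r
  refine ⟨fun a => ∑ m, (1 / 2) * (T a * lam m + T a * (T a - 1) * lam m ^ 2 + (μ a m : ℝ) ^ 2), ?_⟩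
  have hi : ∀ m, Integrable ((fun ω => (arrivals T A α r ω m : ℝ) ^ 2) +
      fun ω => (μ (α r ω) m : ℝ) ^ 2) P := fun m =>
    (S.integrable_arrivals_sq r m).add (S.integrable_of_action r fun a => (μ a m : ℝ) ^ 2)
  have hsum : halfSquares T μ A α r = ∑ m, (1 / 2 : ℝ) •
      ((fun ω => (arrivals T A α r ω m : ℝ) ^ 2) + fun ω => (μ (α r ω) m : ℝ) ^ 2) := by
    ext ω; simp [halfSquares, Finset.mul_sum, mul_add]
  have hterm : ∀ m, P[(1 / 2 : ℝ) • ((fun ω => (arrivals T A α r ω m : ℝ) ^ 2) +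
      fun ω => (μ (α r ω) m : ℝ) ^ 2) | frameInfo ℱ T α S.decided r] =ᵐ[P] fun ω =>
        (1 / 2) * (T (α r ω) * lam m + T (α r ω) * (T (α r ω) - 1) * lam m ^ 2 +
          (μ (α r ω) m : ℝ) ^ 2) := fun m => by
    have h2 := condExp_of_stronglyMeasurable hle
      (S.measurable_of_action r fun a => (μ a m : ℝ) ^ 2).stronglyMeasurable
      (S.integrable_of_action r fun a => (μ a m : ℝ) ^ 2)
    filter_upwards [condExp_smul (1 / 2 : ℝ) ((fun ω => (arrivals T A α r ω m : ℝ) ^ 2) +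
      fun ω => (μ (α r ω) m : ℝ) ^ 2) (frameInfo ℱ T α S.decided r) (μ := P),
      condExp_add (S.integrable_arrivals_sq r m)
        (S.integrable_of_action r fun a => (μ a m : ℝ) ^ 2) (frameInfo ℱ T α S.decided r),
      S.condExp_arrivals_sq r m] with ω h3 h4 h5
    rw [h3, Pi.smul_apply, h4, Pi.add_apply, h5, h2, smul_eq_mul]
  rw [hsum]
  filter_upwards [condExp_finsetSum (s := Finset.univ) (fun m _ => (hi m).smul (1 / 2 : ℝ))
    (frameInfo ℱ T α S.decided r), ae_all_iff.2 hterm] with ω h1 h2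
  rw [h1, Finset.sum_apply]
  exact Finset.sum_congr rfl fun m _ => h2 m

/-- This carries the hypothesis on conditional action probabilities over to arbitrary functions of
the action. -/
theorem condExp_of_action (S : FrameSystem P T μ lam A α ℱ K) (r : ℕ) (f : 𝒜 → ℝ)
    (m' : MeasurableSpace Ω) :
    P[fun ω => f (α r ω) | m'] =ᵐ[P] fun ω => ∑ a, f a *
      (P[({ω | α r ω = a}).indicator (fun _ => (1 : ℝ)) | m']) ω := by
  classical
  have hind : ∀ a, Integrable (({ω | α r ω = a}).indicator (fun _ => (1 : ℝ))) P := fun a => by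
    have := S.integrable_of_action r fun b => if b = a then (1 : ℝ) else 0
    refine this.congr (ae_of_all _ fun ω => ?_)
    simp [Set.indicator_apply]
  have hsum : (fun ω => f (α r ω)) =
      ∑ a, f a • ({ω | α r ω = a}).indicator (fun _ => (1 : ℝ)) := by
    ext ω; simp [Set.indicator_apply]
  rw [hsum]
  filter_upwards [condExp_finsetSum (s := Finset.univ) (fun a _ => (hind a).smul (f a)) m',
    ae_all_iff.2 fun a => condExp_smul (f a) (({ω | α r ω = a}).indicator (fun _ => (1 : ℝ))) m'
      (μ := P)] with ω h1 h2
  rw [h1, Finset.sum_apply]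
  exact Finset.sum_congr rfl fun a _ => by rw [h2 a]; rfl

/-- If the actions depend on the past through the backlog only, then so does the conditional mean
of `halfSquares`. -/
theorem boundGivenHistory_of_backlogBased (S : FrameSystem P T μ lam A α ℱ K) {B : ℝ}
    (hB : BoundGivenBacklog P T μ A α B) (hb : IsBacklogBased P T μ A α) :
    BoundGivenHistory P T μ A α B := by
  intro r
  have hle := (frameInfo ℱ T α S.decided).le r
  obtain ⟨f, hf⟩ := S.exists_condExp_halfSquares r
  -- By the tower property the coefficients `f a` are the same for every coarser σ-algebra, so only
  -- the action probabilities could differ between history and backlog.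
  have key : ∀ m' : MeasurableSpace Ω, m' ≤ frameInfo ℱ T α S.decided r →
      P[halfSquares T μ A α r | m'] =ᵐ[P] fun ω => ∑ a, f a *
        (P[({ω | α r ω = a}).indicator (fun _ => (1 : ℝ)) | m']) ω := fun m' hm' =>
    (condExp_condExp_of_le hm' hle).symm.trans
      ((condExp_congr_ae hf).trans (S.condExp_of_action r f m'))
  filter_upwards [hB r, key _ (historyInfo_le_frameInfo S.decided S.adapted r),
    key _ (S.backlogInfo_le_frameInfo r), ae_all_iff.2 (hb r)] with ω h1 h2 h3 h4
  rw [h2]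
  rw [h3] at h1
  simpa only [h4] using h1

theorem condExp_halfSquares_le (S : FrameSystem P T μ lam A α ℱ K) (r : ℕ)
    {m' : MeasurableSpace Ω} (hm : m' ≤ mΩ) :
    ∀ᵐ ω ∂P, (P[halfSquares T μ A α r | m']) ω ≤ M * (K : ℝ) ^ 2 := by
  have h := condExp_mono (m := m') (S.integrable_halfSquares r) (integrable_const (M * (K : ℝ) ^ 2))
    (ae_of_all P (S.halfSquares_le r))
  rw [condExp_const hm] at h
  exact h

theorem boundGivenBacklog (S : FrameSystem P T μ lam A α ℱ K) :
    BoundGivenBacklog P T μ A α (M * (K : ℝ) ^ 2) := fun r =>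
  S.condExp_halfSquares_le r
    ((S.backlogInfo_le_frameInfo r).trans ((frameInfo ℱ T α S.decided).le r))

theorem boundGivenHistory (S : FrameSystem P T μ lam A α ℱ K) :
    BoundGivenHistory P T μ A α (M * (K : ℝ) ^ 2) := fun r =>
  S.condExp_halfSquares_le r (S.historyInfo_le r)

theorem integral_halfSquares_le (S : FrameSystem P T μ lam A α ℱ K) {B : ℝ}
    (hB : BoundGivenBacklog P T μ A α B) (r : ℕ) : ∫ ω, halfSquares T μ A α r ω ∂P ≤ B := by
  rw [← integral_condExp (μ := P)
    ((S.backlogInfo_le_frameInfo r).trans ((frameInfo ℱ T α S.decided).le r))]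
  calc _ ≤ ∫ _, B ∂P := integral_mono_ae integrable_condExp (integrable_const B) (hB r)
    _ = B := by simp

/-- A flow without traffic never queues. -/
theorem ae_queue_eq_zero (S : FrameSystem P T μ lam A α ℱ K) {m : Fin M} (hm : lam m = 0) :
    ∀ᵐ ω ∂P, ∀ r, queue T μ A α r ω m = 0 := by
  have h : ∀ t, ∀ᵐ ω ∂P, A t ω m = 0 := fun t => by
    have h1 := (integral_eq_zero_iff_of_nonneg (fun ω => Nat.cast_nonneg (A t ω m))
      (S.integrable_arrivals_slot t m)).1 ((S.mean t m).trans hm)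
    filter_upwards [h1] with ω h2
    exact Nat.cast_eq_zero.1 h2
  filter_upwards [ae_all_iff.2 h] with ω hω r
  exact backlog_eq_zero T μ (fun s => α s ω) hω r

end FrameSystem

/-! ### Performance bounds from the drift -/

/-- Beyond n = p/d the cubic term wins; below it the cubic term is dropped. -/
theorem sq_sub_cube_le {p d n : ℝ} (hp : 0 ≤ p) (hd : 0 < d) (hn : 0 ≤ n) :
    p * n ^ 2 - d * n ^ 3 ≤ p * (p / d) ^ 2 := by
  rcases le_total n (p / d) with h | h
  · have h1 : p * n ^ 2 ≤ p * (p / d) ^ 2 := by gcongr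
    have h2 : 0 ≤ d * n ^ 3 := by positivity
    linarith
  · rw [div_le_iff₀ hd] at h
    have h1 : 0 ≤ n ^ 2 * (n * d - p) := mul_nonneg (sq_nonneg n) (by linarith)
    have h2 : 0 ≤ p * (p / d) ^ 2 := by positivity
    nlinarith

theorem summable_sqrt_div_sq (c : ℝ) :
    Summable fun r : ℕ => c * √((r : ℝ) + 1) / ((r : ℝ) + 1) ^ 2 := by
  have h : Summable fun n : ℕ => 1 / (n : ℝ) ^ (3 / 2 : ℝ) :=
    Real.summable_one_div_nat_rpow.2 (by norm_num)
  refine (((summable_nat_add_iff 1).2 h).mul_left c).congr fun r => ?_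
  have hr : (0 : ℝ) < (r : ℝ) + 1 := by positivity
  push_cast
  rw [mul_div_assoc, Real.sqrt_eq_rpow, ← Real.rpow_natCast ((r : ℝ) + 1) 2, ← Real.rpow_sub hr,
    one_div, ← Real.rpow_neg hr.le]
  norm_num

namespace FrameSystem

variable {M : ℕ} {𝒜 : Type*} [Fintype 𝒜] {Ω : Type*} {mΩ : MeasurableSpace Ω} {P : Measure Ω}
  [IsProbabilityMeasure P] {T : 𝒜 → ℕ} {μ : 𝒜 → Fin M → ℕ} {lam : Fin M → ℝ}
  {A : ℕ → Ω → Fin M → ℕ} {α : ℕ → Ω → 𝒜} {ℱ : Filtration ℕ mΩ} {K : ℕ}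

theorem integral_driftNoise (S : FrameSystem P T μ lam A α ℱ K) (r : ℕ) :
    ∫ ω, driftNoise T μ lam A α r ω ∂P = 0 := by
  rw [← integral_condExp (μ := P) ((frameInfo ℱ T α S.decided).le r),
    integral_congr_ae (S.condExp_driftNoise r)]
  simp

theorem integrable_lyapunov_mul_driftNoise (S : FrameSystem P T μ lam A α ℱ K) (r : ℕ) :
    Integrable (lyapunov T μ A α r * driftNoise T μ lam A α r) P :=
  (S.integrable_driftNoise r).bdd_mul (c := (M * (r * K)) ^ 2 / 2)
    (S.measurable_lyapunov_ambient r).aestronglyMeasurable (ae_of_all _ (S.abs_lyapunov_le r))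

/-- If the drift is at least `δ` times the total backlog, the second moment of the Lyapunov function
grows at most linearly. -/
theorem exists_integral_lyapunov_sq_le (S : FrameSystem P T μ lam A α ℱ K) {δ : ℝ} (hδ : 0 < δ)
    (hG : ∀ r, ∀ᵐ ω ∂P, δ * totalQueue T μ A α r ω ≤ driftGain T μ lam A α r ω) :
    ∃ C : ℝ, 0 ≤ C ∧ ∀ r : ℕ, ∫ ω, lyapunov T μ A α r ω ^ 2 ∂P ≤ C * r := by
  set b : ℝ := M * (K : ℝ) ^ 2 with hb
  have hb0 : 0 ≤ b := by positivity
  -- The coefficient of n²: `b` comes from 2LY with L ≤ n²/2, and 8K² from the squared increment.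
  set p : ℝ := b + 8 * (K : ℝ) ^ 2 with hp
  have hp0 : 0 ≤ p := by positivity
  have hd : 0 < δ / (M + 1) := by positivity
  set C : ℝ := 2 * b ^ 2 + p * (p / (δ / (M + 1))) ^ 2 with hC
  have step : ∀ r, ∀ᵐ ω ∂P, lyapunov T μ A α (r + 1) ω ^ 2 ≤ lyapunov T μ A α r ω ^ 2 +
      2 * (lyapunov T μ A α r ω * driftNoise T μ lam A α r ω) + C := by
    intro r
    filter_upwards [hG r] with ω hω
    have hL' := lyapunov_nonneg T μ A α (r + 1) ω
    have hL := lyapunov_nonneg T μ A α r ω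
    have hs := lyapunov_succ_le T μ lam A α r ω
    have hn := totalQueue_nonneg T μ A α r ω
    have hY0 := halfSquares_nonneg T μ A α r ω
    have hY := S.halfSquares_le r ω
    have hN := abs_le.1 (S.abs_driftNoise_le r ω)
    have hG' := abs_le.1 (S.abs_driftGain_le r ω)
    have hLn := lyapunov_le_totalQueue_sq T μ A α r ω
    have hnL := totalQueue_sq_le_lyapunov T μ A α r ω
    generalize lyapunov T μ A α (r + 1) ω = L' at *
    generalize lyapunov T μ A α r ω = L at *
    generalize totalQueue T μ A α r ω = n at *
    generalize halfSquares T μ A α r ω = Y at *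
    generalize driftNoise T μ lam A α r ω = N at *
    generalize driftGain T μ lam A α r ω = G at *
    have h1 : L' ^ 2 ≤ (L + (Y + N - G)) ^ 2 := pow_le_pow_left₀ hL' hs 2
    have h2 : (Y + N - G) ^ 2 ≤ (b + 2 * (K * n)) ^ 2 := by
      refine sq_le_sq' ?_ ?_ <;> linarith [hN.1, hN.2, hG'.1, hG'.2]
    have h3 : (b + 2 * (K * n)) ^ 2 ≤ 2 * b ^ 2 + 8 * (K : ℝ) ^ 2 * n ^ 2 := by
      nlinarith [sq_nonneg (b - 2 * (K * n))]
    -- The decisive negative term: L ≥ n² / (2(M+1)) and G ≥ δn make 2LG cubic in the total backlog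
    -- n.
    have h4 : 2 * (L * (Y - G)) ≤ b * n ^ 2 - δ / (M + 1) * n ^ 3 := by
      have h5 : L * (Y - G) ≤ L * (b - δ * n) := mul_le_mul_of_nonneg_left (by linarith) hL
      have h6 : L * b ≤ n ^ 2 / 2 * b := mul_le_mul_of_nonneg_right hLn hb0
      have h7 : δ / (M + 1) * n ^ 3 ≤ 2 * (L * (δ * n)) := by
        calc δ / (M + 1) * n ^ 3 = δ / (M + 1) * n * n ^ 2 := by ring
          _ ≤ δ / (M + 1) * n * (2 * (M + 1) * L) := by gcongr
          _ = 2 * (L * (δ * n)) := by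
            have : (M : ℝ) + 1 ≠ 0 := Nat.cast_add_one_ne_zero M
            field_simp
      linarith
    have h8 := sq_sub_cube_le hp0 hd hn
    have h9 : (L + (Y + N - G)) ^ 2 =
        L ^ 2 + 2 * (L * N) + 2 * (L * (Y - G)) + (Y + N - G) ^ 2 := by ring
    have h10 : p * n ^ 2 = b * n ^ 2 + 8 * (K : ℝ) ^ 2 * n ^ 2 := by rw [hp]; ring
    linarith
  refine ⟨C, by positivity, fun r => ?_⟩
  induction r with
  | zero => simp [lyapunov_zero]
  | succ r ih =>
    have hLN : Integrable (fun ω =>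
        2 * (lyapunov T μ A α r ω * driftNoise T μ lam A α r ω)) P :=
      (S.integrable_lyapunov_mul_driftNoise r).const_mul 2
    have hadd : Integrable (fun ω => lyapunov T μ A α r ω ^ 2 +
        2 * (lyapunov T μ A α r ω * driftNoise T μ lam A α r ω)) P :=
      (S.integrable_lyapunov_sq r).add hLN
    have h1 := integral_mono_ae (S.integrable_lyapunov_sq (r + 1))
      (hadd.add (integrable_const C)) (step r)
    have h2 : ∫ ω, (lyapunov T μ A α r ω ^ 2 +
        2 * (lyapunov T μ A α r ω * driftNoise T μ lam A α r ω) + C) ∂P =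
        ∫ ω, lyapunov T μ A α r ω ^ 2 ∂P + C := by
      rw [integral_add hadd (integrable_const C), integral_add (S.integrable_lyapunov_sq r) hLN,
        integral_const_mul, integral_mul_eq_zero_of_condExp ((frameInfo ℱ T α S.decided).le r)
          (S.measurable_lyapunov r) (S.integrable_lyapunov_mul_driftNoise r)
          (S.integrable_driftNoise r) (S.condExp_driftNoise r)]
      simp
    have h3 : ∫ ω, lyapunov T μ A α (r + 1) ω ^ 2 ∂P ≤
        ∫ ω, lyapunov T μ A α r ω ^ 2 ∂P + C := h1.trans_eq h2
    push_cast
    linarith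

/-- Under a drift proportional to the backlog the averages of the noise terms vanish. -/
theorem tendsto_average_driftNoise (S : FrameSystem P T μ lam A α ℱ K) {δ : ℝ} (hδ : 0 < δ)
    (hG : ∀ r, ∀ᵐ ω ∂P, δ * totalQueue T μ A α r ω ≤ driftGain T μ lam A α r ω) :
    ∀ᵐ ω ∂P, Tendsto (fun R : ℕ => (1 / (R : ℝ)) *
      ∑ r ∈ Finset.range R, driftNoise T μ lam A α r ω) atTop (𝓝 0) := by
  obtain ⟨C, hC0, hC⟩ := S.exists_integral_lyapunov_sq_le hδ hG
  -- From L ≤ L²/(2s) + s/2 with s = √(r+1), the choice that balances E L² ≤ C s².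
  have hL : ∀ r : ℕ, ∫ ω, lyapunov T μ A α r ω ∂P ≤ (C + 1) / 2 * √((r : ℝ) + 1) := by
    intro r
    set s := √((r : ℝ) + 1) with hs
    have hs2 : s ^ 2 = r + 1 := Real.sq_sqrt (by positivity)
    have hs0 : 0 < s := Real.sqrt_pos.2 (by positivity)
    calc ∫ ω, lyapunov T μ A α r ω ∂P
        ≤ ∫ ω, ((1 / (2 * s)) * lyapunov T μ A α r ω ^ 2 + s / 2) ∂P := by
          refine integral_mono (S.integrable_lyapunov r)
            (((S.integrable_lyapunov_sq r).const_mul _).add (integrable_const _)) fun ω => ?_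
          have h1 : (1 / (2 * s)) * lyapunov T μ A α r ω ^ 2 + s / 2 - lyapunov T μ A α r ω =
              (lyapunov T μ A α r ω - s) ^ 2 / (2 * s) := by
            field_simp
            ring
          have h2 : 0 ≤ (lyapunov T μ A α r ω - s) ^ 2 / (2 * s) := by positivity
          change lyapunov T μ A α r ω ≤ (1 / (2 * s)) * lyapunov T μ A α r ω ^ 2 + s / 2
          linarith
      _ = (1 / (2 * s)) * ∫ ω, lyapunov T μ A α r ω ^ 2 ∂P + s / 2 := by
          rw [integral_add ((S.integrable_lyapunov_sq r).const_mul _) (integrable_const _),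
            integral_const_mul]
          simp
      _ ≤ (1 / (2 * s)) * (C * s ^ 2) + s / 2 := by
          have h1 : ∫ ω, lyapunov T μ A α r ω ^ 2 ∂P ≤ C * s ^ 2 := by
            rw [hs2]
            have := hC r
            linarith
          gcongr
      _ = (C + 1) / 2 * s := by
          field_simp
  refine tendsto_average_martingale_difference (frameInfo ℱ T α S.decided)
    (b := fun r => K * (M * (r * K)))
    (v := fun r => (K : ℝ) ^ 2 * (2 * (M + 1)) * ((C + 1) / 2) * √((r : ℝ) + 1))
    S.measurable_driftNoise (fun r => ae_of_all _ fun ω => (S.abs_driftNoise_le r ω).trans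
      (mul_le_mul_of_nonneg_left (S.totalQueue_le r ω) (Nat.cast_nonneg K)))
    S.condExp_driftNoise (fun r => ?_) (summable_sqrt_div_sq _)
  have hpt : ∀ ω, driftNoise T μ lam A α r ω ^ 2 ≤
      (K : ℝ) ^ 2 * (2 * (M + 1)) * lyapunov T μ A α r ω := fun ω => by
    calc driftNoise T μ lam A α r ω ^ 2 ≤ (K * totalQueue T μ A α r ω) ^ 2 := by
          rw [← sq_abs]
          exact pow_le_pow_left₀ (abs_nonneg _) (S.abs_driftNoise_le r ω) 2
      _ = (K : ℝ) ^ 2 * totalQueue T μ A α r ω ^ 2 := by ring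
      _ ≤ (K : ℝ) ^ 2 * (2 * (M + 1) * lyapunov T μ A α r ω) :=
          mul_le_mul_of_nonneg_left (totalQueue_sq_le_lyapunov T μ A α r ω) (sq_nonneg _)
      _ = _ := by ring
  calc ∫ ω, driftNoise T μ lam A α r ω ^ 2 ∂P
      ≤ ∫ ω, (K : ℝ) ^ 2 * (2 * (M + 1)) * lyapunov T μ A α r ω ∂P :=
        integral_mono_of_nonneg (ae_of_all _ fun ω => sq_nonneg _)
          ((S.integrable_lyapunov r).const_mul _) (ae_of_all _ hpt)
    _ = (K : ℝ) ^ 2 * (2 * (M + 1)) * ∫ ω, lyapunov T μ A α r ω ∂P := integral_const_mul _ _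
    _ ≤ _ := by
        rw [mul_assoc _ ((C + 1) / 2)]
        exact mul_le_mul_of_nonneg_left (hL r) (by positivity)

/-- The history filtration. -/
def historyFiltration (S : FrameSystem P T μ lam A α ℱ K) : Filtration ℕ mΩ where
  seq r := historyInfo T A α r
  mono' := historyInfo_mono T A α
  le' := S.historyInfo_le

/-- The averages of `halfSquares` minus its conditional means given the history vanish. -/
theorem tendsto_average_halfSquares_sub (S : FrameSystem P T μ lam A α ℱ K) :
    ∀ᵐ ω ∂P, Tendsto (fun R : ℕ => (1 / (R : ℝ)) * ∑ r ∈ Finset.range R,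
      (halfSquares T μ A α r ω - (P[halfSquares T μ A α r | historyInfo T A α r]) ω))
      atTop (𝓝 0) := by
  set b : ℝ := M * (K : ℝ) ^ 2 with hb
  have hcb : ∀ r, ∀ᵐ ω ∂P, |halfSquares T μ A α r ω -
      (P[halfSquares T μ A α r | historyInfo T A α r]) ω| ≤ 2 * b := fun r => by
    filter_upwards [ae_bdd_abs_condExp_of_ae_bdd_abs (m := historyInfo T A α r)
      (ae_of_all P (S.abs_halfSquares_le r))] with ω h1
    have h2 := S.abs_halfSquares_le r ω
    have h3 := abs_sub (halfSquares T μ A α r ω)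
      ((P[halfSquares T μ A α r | historyInfo T A α r]) ω)
    linarith
  have hm : ∀ r, Measurable[historyInfo T A α (r + 1)] fun ω => halfSquares T μ A α r ω -
      (P[halfSquares T μ A α r | historyInfo T A α r]) ω := fun r =>
    (measurable_halfSquares_historyInfo T μ A α r).sub
      (stronglyMeasurable_condExp.measurable.mono (historyInfo_mono T A α (Nat.le_succ r)) le_rfl)
  -- The variances are bounded by a constant; the factor √(r+1) ≥ 1 only reuses the summability
  -- already established.
  refine tendsto_average_martingale_difference S.historyFiltration (b := fun _ => 2 * b)
    (v := fun r => (2 * b) ^ 2 * √((r : ℝ) + 1)) hm hcb (fun r => ?_) (fun r => ?_)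
    (summable_sqrt_div_sq _)
  · have h1 := condExp_sub (S.integrable_halfSquares r)
      (integrable_condExp (m := historyInfo T A α r) (μ := P) (f := halfSquares T μ A α r))
      (historyInfo T A α r)
    have h2 := condExp_of_stronglyMeasurable (S.historyInfo_le r)
      (stronglyMeasurable_condExp (m := historyInfo T A α r) (μ := P) (f := halfSquares T μ A α r))
      integrable_condExp
    rw [h2, sub_self] at h1
    exact h1
  · have h1 : ∫ ω, (halfSquares T μ A α r ω -
        (P[halfSquares T μ A α r | historyInfo T A α r]) ω) ^ 2 ∂P ≤ ∫ _, (2 * b) ^ 2 ∂P := by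
      refine integral_mono_of_nonneg (ae_of_all _ fun ω => sq_nonneg _) (integrable_const _) ?_
      filter_upwards [hcb r] with ω h
      rw [← sq_abs]
      exact pow_le_pow_left₀ (abs_nonneg _) h 2
    refine h1.trans ?_
    simp only [integral_const, probReal_univ, one_smul]
    refine le_mul_of_one_le_right (sq_nonneg _) ?_
    rw [Real.one_le_sqrt]
    linarith [Nat.cast_nonneg (α := ℝ) r]

/-- Mean backlog bound from a drift `θ ∑ w Q`. -/
theorem meanBacklogLE (S : FrameSystem P T μ lam A α ℱ K) {w : Fin M → ℝ} {θ : ℝ} (hθ : 0 < θ)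
    (hG : ∀ r, ∀ᵐ ω ∂P, θ * ∑ m, w m * (queue T μ A α r ω m : ℝ) ≤ driftGain T μ lam A α r ω)
    {B : ℝ} (hB : BoundGivenBacklog P T μ A α B) : MeanBacklogLE P T μ A α w (θ⁻¹ * B) := by
  refine ⟨S.integrable_queue, fun R hR => ?_⟩
  have hwi : ∀ r, Integrable (fun ω => ∑ m, w m * (queue T μ A α r ω m : ℝ)) P := fun r =>
    integrable_finsetSum _ fun m _ => (S.integrable_queue r m).const_mul (w m)
  have hw : ∀ r, ∫ ω, ∑ m, w m * (queue T μ A α r ω m : ℝ) ∂P =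
      ∑ m, w m * ∫ ω, (queue T μ A α r ω m : ℝ) ∂P := fun r => by
    rw [integral_finsetSum _ fun m _ => (S.integrable_queue r m).const_mul (w m)]
    simp_rw [integral_const_mul]
  -- Telescoped drift: the start is empty, the noise has mean zero, and each frame adds at most `B`.
  have key : ∀ R : ℕ, ∫ ω, lyapunov T μ A α R ω ∂P +
      θ * ∑ r ∈ Finset.range R, ∑ m, w m * ∫ ω, (queue T μ A α r ω m : ℝ) ∂P ≤ R * B := by
    intro R
    induction R with
    | zero => simp [lyapunov_zero]
    | succ R ih =>
      have hLY : Integrable (fun ω => lyapunov T μ A α R ω + halfSquares T μ A α R ω) P :=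
        (S.integrable_lyapunov R).add (S.integrable_halfSquares R)
      have hLYN : Integrable (fun ω => lyapunov T μ A α R ω + halfSquares T μ A α R ω +
          driftNoise T μ lam A α R ω) P := hLY.add (S.integrable_driftNoise R)
      have h1 : ∫ ω, lyapunov T μ A α (R + 1) ω ∂P ≤
          ∫ ω, (lyapunov T μ A α R ω + halfSquares T μ A α R ω + driftNoise T μ lam A α R ω -
            θ * ∑ m, w m * (queue T μ A α R ω m : ℝ)) ∂P := by
        refine integral_mono_ae (S.integrable_lyapunov (R + 1)) (hLYN.sub ((hwi R).const_mul θ)) ?_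
        filter_upwards [hG R] with ω hω
        have := lyapunov_succ_le T μ lam A α R ω
        linarith
      rw [integral_sub hLYN ((hwi R).const_mul θ), integral_add hLY (S.integrable_driftNoise R),
        integral_add (S.integrable_lyapunov R) (S.integrable_halfSquares R), integral_const_mul,
        hw, S.integral_driftNoise] at h1
      have h2 := S.integral_halfSquares_le hB R
      rw [Finset.sum_range_succ, mul_add]
      push_cast
      linarith
  have h1 := key R
  have h2 : 0 ≤ ∫ ω, lyapunov T μ A α R ω ∂P :=
    integral_nonneg fun ω => lyapunov_nonneg T μ A α R ω
  have hR' : (0 : ℝ) < R := by exact_mod_cast hR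
  rw [one_div, inv_mul_le_iff₀ hR', inv_mul_eq_div, ← mul_div_assoc, le_div_iff₀ hθ]
  linarith

/-- Almost sure backlog bound from a drift `θ ∑ w Q`. -/
theorem pathBacklogLE (S : FrameSystem P T μ lam A α ℱ K) {w : Fin M → ℝ} {θ c : ℝ} (hθ : 0 < θ)
    (hc : 0 < c)
    (hG : ∀ r, ∀ᵐ ω ∂P, θ * ∑ m, w m * (queue T μ A α r ω m : ℝ) ≤ driftGain T μ lam A α r ω)
    (hcw : ∀ r, ∀ᵐ ω ∂P, c * totalQueue T μ A α r ω ≤ ∑ m, w m * (queue T μ A α r ω m : ℝ))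
    {B : ℝ} (hB : BoundGivenHistory P T μ A α B) : PathBacklogLE P T μ A α w (θ⁻¹ * B) := by
  -- The law for the noise needs a gain proportional to the unweighted backlog.
  have hδ : ∀ r, ∀ᵐ ω ∂P, θ * c * totalQueue T μ A α r ω ≤ driftGain T μ lam A α r ω := fun r => by
    filter_upwards [hG r, hcw r] with ω h1 h2
    have := mul_le_mul_of_nonneg_left h2 hθ.le
    linarith
  filter_upwards [S.tendsto_average_driftNoise (mul_pos hθ hc) hδ,
    S.tendsto_average_halfSquares_sub, ae_all_iff.2 hG, ae_all_iff.2 hB] with ω h1 h2 h3 h4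
  have hlim := ((h2.add_const B).add h1).const_mul θ⁻¹
  rw [zero_add, add_zero] at hlim
  have hlim' := (continuous_coe_real_ereal.tendsto _).comp hlim
  rw [← hlim'.limsup_eq]
  refine limsup_le_limsup ?_
  filter_upwards [eventually_gt_atTop 0] with R hR
  have hR' : (0 : ℝ) < R := by exact_mod_cast hR
  simp only [Function.comp]
  rw [EReal.coe_le_coe_iff]
  -- The telescoped drift on one path, with Y split into its martingale difference and its
  -- conditional mean, the latter at most `B`.
  have key : ∀ R : ℕ, lyapunov T μ A α R ω +
      θ * ∑ r ∈ Finset.range R, ∑ m, w m * (queue T μ A α r ω m : ℝ) ≤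
      ∑ r ∈ Finset.range R, (halfSquares T μ A α r ω -
        (P[halfSquares T μ A α r | historyInfo T A α r]) ω) + R * B +
        ∑ r ∈ Finset.range R, driftNoise T μ lam A α r ω := by
    intro R
    induction R with
    | zero => simp [lyapunov_zero]
    | succ R ih =>
      have h5 := lyapunov_succ_le T μ lam A α R ω
      have h6 := h3 R
      have h7 := h4 R
      simp only [Finset.sum_range_succ _ R, mul_add]
      push_cast
      linarith
  have h5 := key R
  have h6 := lyapunov_nonneg T μ A α R ω
  rw [inv_mul_eq_div, le_div_iff₀ hθ, one_div, mul_assoc, inv_mul_le_iff₀ hR', mul_add, mul_add,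
    mul_inv_cancel_left₀ hR'.ne', mul_inv_cancel_left₀ hR'.ne']
  linarith

theorem weightedBacklogBound (S : FrameSystem P T μ lam A α ℱ K) {θ c : ℝ} (hθ : 0 < θ)
    (hc : 0 < c)
    (hG : ∀ r, ∀ᵐ ω ∂P, θ * ∑ m, lam m * (queue T μ A α r ω m : ℝ) ≤ driftGain T μ lam A α r ω)
    (hcw : ∀ r, ∀ᵐ ω ∂P, c * totalQueue T μ A α r ω ≤ ∑ m, lam m * (queue T μ A α r ω m : ℝ)) :
    WeightedBacklogBound P T μ lam A α θ⁻¹ := fun _ =>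
  ⟨fun hB => S.meanBacklogLE hθ hG hB,
    fun hB hb => S.pathBacklogLE hθ hc hG hcw (S.boundGivenHistory_of_backlogBased hB hb),
    fun hB => S.pathBacklogLE hθ hc hG hcw hB⟩

end FrameSystem

/-! ### Backlog bounds for the max-weight algorithms -/

theorem exists_pos_le_of_ne_zero {ι : Type*} [Finite ι] {w : ι → ℝ} (hw : ∀ i, 0 ≤ w i) :
    ∃ c : ℝ, 0 < c ∧ ∀ i, w i ≠ 0 → c ≤ w i := by
  have hfin : (Set.range w \ {0}).Finite := (Set.finite_range w).subset Set.sdiff_subset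
  rcases (Set.range w \ {0}).eq_empty_or_nonempty with h | h
  · refine ⟨1, one_pos, fun i hi => ?_⟩
    have : w i ∈ Set.range w \ {0} := ⟨⟨i, rfl⟩, hi⟩
    simp [h] at this
  · obtain ⟨c, ⟨⟨i, rfl⟩, hc⟩, hmin⟩ := Set.exists_min_image _ id hfin h
    exact ⟨w i, lt_of_le_of_ne (hw i) (Ne.symm hc), fun j hj => hmin _ ⟨⟨j, rfl⟩, hj⟩⟩

theorem nonneg_of_mem_capacityRegion {M : ℕ} {𝒜 : Type*} {T : 𝒜 → ℕ} {μ : 𝒜 → Fin M → ℕ}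
    {lam : Fin M → ℝ} (h : lam ∈ capacityRegion T μ) (m : Fin M) : 0 ≤ lam m := by
  obtain ⟨Ω, mΩ, P, hP, A, α, hiid, -, -⟩ := h
  rw [← hiid.mean 0 m]
  exact integral_nonneg fun _ => Nat.cast_nonneg _

theorem exists_bound {M : ℕ} {𝒜 : Type*} [Fintype 𝒜] (T : 𝒜 → ℕ) (μ : 𝒜 → Fin M → ℕ) :
    ∃ K : ℕ, (∀ a, T a ≤ K) ∧ ∀ a m, μ a m ≤ K := by
  have h : ∀ a, T a + ∑ m, μ a m ≤ ∑ a, (T a + ∑ m, μ a m) := fun a =>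
    Finset.single_le_sum (f := fun a => T a + ∑ m, μ a m) (fun _ _ => Nat.zero_le _)
      (Finset.mem_univ a)
  refine ⟨∑ a, (T a + ∑ m, μ a m), fun a => (Nat.le_add_right _ _).trans (h a), fun a m => ?_⟩
  have := Finset.single_le_sum (f := fun m => μ a m) (fun _ _ => Nat.zero_le _) (Finset.mem_univ m)
  exact this.trans ((Nat.le_add_left _ _).trans (h a))

/-- Load zero is separate because the drift rate relative to Σ λ_m Q_m is (1-ρ)/ρ, which has no
meaning at ρ = 0. -/
theorem weightedBacklogBound_zero {M : ℕ} {𝒜 : Type*} [Fintype 𝒜] {Ω : Type*}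
    {mΩ : MeasurableSpace Ω} {P : Measure Ω} [IsProbabilityMeasure P] {T : 𝒜 → ℕ}
    {μ : 𝒜 → Fin M → ℕ} {A : ℕ → Ω → Fin M → ℕ} {α : ℕ → Ω → 𝒜} {ℱ : Filtration ℕ mΩ} {K : ℕ}
    (S : FrameSystem P T μ 0 A α ℱ K) : WeightedBacklogBound P T μ 0 A α 0 := by
  have h : ∀ B : ℝ, PathBacklogLE P T μ A α 0 (0 * B) := fun B => ae_of_all _ fun ω => by
    simp
  exact fun B => ⟨fun _ => ⟨S.integrable_queue, fun R _ => by simp⟩, fun _ _ => h B, fun _ => h B⟩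

namespace FrameSystem

variable {M : ℕ} {𝒜 : Type*} [Fintype 𝒜] {Ω : Type*} {mΩ : MeasurableSpace Ω} {P : Measure Ω}
  [IsProbabilityMeasure P] {T : 𝒜 → ℕ} {μ : 𝒜 → Fin M → ℕ} {lam : Fin M → ℝ}
  {A : ℕ → Ω → Fin M → ℕ} {α : ℕ → Ω → 𝒜} {ℱ : Filtration ℕ mΩ} {K : ℕ}

/-- Flows of weight zero have no traffic, so their queues are almost surely empty; all other weights
are at least `c`. -/
theorem ae_mul_totalQueue_le (S : FrameSystem P T μ lam A α ℱ K) {w : Fin M → ℝ} {c : ℝ}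
    (hw : ∀ m, w m = 0 → lam m = 0) (hc : ∀ m, w m ≠ 0 → c ≤ w m) (r : ℕ) :
    ∀ᵐ ω ∂P, c * totalQueue T μ A α r ω ≤ ∑ m, w m * (queue T μ A α r ω m : ℝ) := by
  have h : ∀ m, ∀ᵐ ω ∂P, c * (queue T μ A α r ω m : ℝ) ≤ w m * queue T μ A α r ω m := fun m => by
    by_cases hm : w m = 0
    · filter_upwards [S.ae_queue_eq_zero (hw m hm)] with ω hω
      simp [hω r]
    · exact ae_of_all _ fun ω => mul_le_mul_of_nonneg_right (hc m hm) (Nat.cast_nonneg _)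
  filter_upwards [ae_all_iff.2 h] with ω hω
  rw [totalQueue, Finset.mul_sum]
  exact Finset.sum_le_sum fun m _ => hω m

theorem weightedBacklogBound_of_drift (S : FrameSystem P T μ lam A α ℱ K) {θ : ℝ} (hθ : 0 < θ)
    (hG : ∀ r ω, θ * ∑ m, lam m * (queue T μ A α r ω m : ℝ) ≤ driftGain T μ lam A α r ω) :
    WeightedBacklogBound P T μ lam A α θ⁻¹ := by
  obtain ⟨c, hc, hcl⟩ := exists_pos_le_of_ne_zero S.lam_nonneg
  exact S.weightedBacklogBound hθ hc (fun r => ae_of_all _ (hG r))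
    (S.ae_mul_totalQueue_le (fun _ h => h) hcl)

theorem weightedBacklogBound_maxWeight1 (S : FrameSystem P T μ lam A α ℱ K) (hT : ∀ a, 1 ≤ T a)
    {ρ : ℝ} (hρ : 0 < ρ) (hρ1 : ρ < 1) {w : Fin M → ℝ} (hw : lam = ρ • w) {p : 𝒜 → ℝ}
    (hp : IsStationaryPolicy T μ w 1 p) (hα : IsMaxWeight1 T μ lam A α) :
    WeightedBacklogBound P T μ lam A α (ρ / ((∑ a, p a * (T a : ℝ)) * (1 - ρ))) := by
  have hTs : 0 < ∑ a, p a * (T a : ℝ) := one_pos.trans_le (one_le_mean_frame T hT hp.1 hp.2.1)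
  have hθ : 0 < (∑ a, p a * (T a : ℝ)) * (1 - ρ) / ρ :=
    div_pos (mul_pos hTs (sub_pos.2 hρ1)) hρ
  rw [← inv_div]
  refine S.weightedBacklogBound_of_drift hθ fun r ω => ?_
  refine le_trans (le_of_eq ?_) (maxWeight1_drift_of_le T μ hT hp hw
    (fun m => Nat.cast_nonneg (queue T μ A α r ω m)) (hα r ω))
  rw [hw, Finset.mul_sum, Finset.mul_sum]
  refine Finset.sum_congr rfl fun m _ => ?_
  rw [Pi.smul_apply, smul_eq_mul]
  field_simp

/-- Under both algorithms the drift at load `ρ • w` is at least `(1 - ρ) ∑ w Q`. -/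
theorem drift_maxWeight (hT : ∀ a, 1 ≤ T a)
    {ρ : ℝ} (hρ1 : ρ < 1) {w : Fin M → ℝ} (hw0 : ∀ m, 0 ≤ w m) (hw : lam = ρ • w) {p : 𝒜 → ℝ}
    (hp : IsStationaryPolicy T μ w 1 p)
    (hα : IsMaxWeight1 T μ lam A α ∨ IsMaxWeight2 T μ A α) (r : ℕ) (ω : Ω) :
    (1 - ρ) * ∑ m, w m * (queue T μ A α r ω m : ℝ) ≤ driftGain T μ lam A α r ω := by
  have hq : ∀ m, (0 : ℝ) ≤ queue T μ A α r ω m := fun m => Nat.cast_nonneg _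
  rcases hα with hα | hα
  · refine le_trans ?_ (maxWeight1_drift_of_le T μ hT hp hw hq (hα r ω))
    rw [mul_assoc]
    exact le_mul_of_one_le_left (mul_nonneg (sub_nonneg.2 hρ1.le)
      (Finset.sum_nonneg fun m _ => mul_nonneg (hw0 m) (hq m)))
      (one_le_mean_frame T hT hp.1 hp.2.1)
  · exact maxWeight2_drift_of_le T μ hρ1.le hw0 hT hp hw hq (hα r ω)

theorem weightedBacklogBound_maxWeight (S : FrameSystem P T μ lam A α ℱ K) (hT : ∀ a, 1 ≤ T a)
    {ρ : ℝ} (hρ : 0 < ρ) (hρ1 : ρ < 1) {w : Fin M → ℝ} (hw0 : ∀ m, 0 ≤ w m) (hw : lam = ρ • w)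
    {p : 𝒜 → ℝ} (hp : IsStationaryPolicy T μ w 1 p)
    (hα : IsMaxWeight1 T μ lam A α ∨ IsMaxWeight2 T μ A α) :
    WeightedBacklogBound P T μ lam A α (ρ / (1 - ρ)) := by
  rw [← inv_div]
  refine S.weightedBacklogBound_of_drift (div_pos (sub_pos.2 hρ1) hρ) fun r ω => ?_
  refine le_trans (le_of_eq ?_) (drift_maxWeight hT hρ1 hw0 hw hp hα r ω)
  rw [hw, Finset.mul_sum, Finset.mul_sum]
  refine Finset.sum_congr rfl fun m _ => ?_
  rw [Pi.smul_apply, smul_eq_mul]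
  field_simp

/-- Total backlog along a ray, where `c` is a lower bound on the non-zero rates of `w`. -/
theorem totalBacklogLE_maxWeight (S : FrameSystem P T μ lam A α ℱ K) (hT : ∀ a, 1 ≤ T a)
    {ρ c : ℝ} (hρ1 : ρ < 1) (hc : 0 < c) {w : Fin M → ℝ} (hw0 : ∀ m, 0 ≤ w m)
    (hcw : ∀ m, w m ≠ 0 → c ≤ w m) (hw : lam = ρ • w)
    {p : 𝒜 → ℝ} (hp : IsStationaryPolicy T μ w 1 p)
    (hα : IsMaxWeight1 T μ lam A α ∨ IsMaxWeight2 T μ A α) :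
    MeanBacklogLE P T μ A α (fun _ => 1) (M * (K : ℝ) ^ 2 / c / (1 - ρ)) ∧
      PathBacklogLE P T μ A α (fun _ => 1) (M * (K : ℝ) ^ 2 / c / (1 - ρ)) := by
  have h1ρ : 0 < 1 - ρ := sub_pos.2 hρ1
  have hθ : 0 < (1 - ρ) * c := mul_pos h1ρ hc
  -- Measuring the drift against `w` rather than `ρ • w` keeps `c` independent of `ρ` and includes
  -- `ρ = 0`.
  have hG : ∀ r, ∀ᵐ ω ∂P, (1 - ρ) * c * ∑ m, (1 : ℝ) * (queue T μ A α r ω m : ℝ) ≤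
      driftGain T μ lam A α r ω := fun r => by
    filter_upwards [S.ae_mul_totalQueue_le (w := w) (fun m h => by simp [hw, h]) hcw r] with ω hω
    refine le_trans ?_ (drift_maxWeight hT hρ1 hw0 hw hp hα r ω)
    simp_rw [one_mul]
    rw [mul_assoc]
    exact mul_le_mul_of_nonneg_left hω h1ρ.le
  have hC : M * (K : ℝ) ^ 2 / c / (1 - ρ) = ((1 - ρ) * c)⁻¹ * (M * (K : ℝ) ^ 2) := by
    field_simp
  rw [hC]
  refine ⟨S.meanBacklogLE hθ hG S.boundGivenBacklog,
    S.pathBacklogLE hθ one_pos hG (fun r => ae_of_all _ fun ω => ?_) S.boundGivenHistory⟩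
  simp [totalQueue]

end FrameSystem

end IndexCoding

/-! ### The main theorem -/

theorem mainTheorem7 {M : ℕ} {𝒜 : Type*} [Fintype 𝒜]
    (T : 𝒜 → ℕ) (hT : ∀ a, 1 ≤ T a) (μ : 𝒜 → Fin M → ℕ) :
    -- the weighted average backlog is at most `B ρ / (1 - ρ)` under both algorithms
    (∀ (Ω : Type*) [MeasurableSpace Ω] (P : Measure Ω) [IsProbabilityMeasure P]
        (lam : Fin M → ℝ) (A : ℕ → Ω → Fin M → ℕ) (α : ℕ → Ω → 𝒜) (ρ : ℝ),
        0 ≤ ρ → ρ < 1 → lam ∈ ρ • capacityRegion T μ → IsSystem P T lam A α →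
        (IsMaxWeight1 T μ lam A α ∨ IsMaxWeight2 T μ A α →
          WeightedBacklogBound P T μ lam A α (ρ / (1 - ρ))) ∧
        (∃ p, IsStationaryPolicy T μ lam ρ p) ∧
        (IsMaxWeight1 T μ lam A α → ∀ p, IsStationaryPolicy T μ lam ρ p →
          WeightedBacklogBound P T μ lam A α (ρ / ((∑ a, p a * (T a : ℝ)) * (1 - ρ))))) ∧
    -- an admissible constant `B` exists that depends on the action set only
    (∃ B : ℝ, ∀ (Ω : Type*) [MeasurableSpace Ω] (P : Measure Ω) [IsProbabilityMeasure P]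
        (lam : Fin M → ℝ) (A : ℕ → Ω → Fin M → ℕ) (α : ℕ → Ω → 𝒜),
        IsSystem P T lam A α →
          BoundGivenBacklog P T μ A α B ∧ BoundGivenHistory P T μ A α B) ∧
    -- the average total queue size is `O(1 / (1 - ρ))` along each ray `ρ • lam₀`
    (∀ lam₀ ∈ capacityRegion T μ, ∃ C : ℝ, ∀ (Ω : Type*) [MeasurableSpace Ω] (P : Measure Ω)
        [IsProbabilityMeasure P] (A : ℕ → Ω → Fin M → ℕ) (α : ℕ → Ω → 𝒜) (ρ : ℝ),
        0 ≤ ρ → ρ < 1 → IsSystem P T (ρ • lam₀) A α →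
        (IsMaxWeight1 T μ (ρ • lam₀) A α ∨ IsMaxWeight2 T μ A α) →
          MeanBacklogLE P T μ A α (fun _ => 1) (C / (1 - ρ)) ∧
          PathBacklogLE P T μ A α (fun _ => 1) (C / (1 - ρ))) := by
  obtain ⟨K, hKT, hKμ⟩ := exists_bound T μ
  refine ⟨?_, ⟨M * (K : ℝ) ^ 2, ?_⟩, ?_⟩
  · intro Ω _ P _ lam A α ρ hρ hρ1 hlam hS
    obtain ⟨ℱ, S⟩ := hS.exists_frameSystem (μ := μ) hKT hKμ
    obtain ⟨w, hw, hlam⟩ := hlam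
    have hlam : lam = ρ • w := hlam.symm
    obtain ⟨p, hp⟩ := exists_stationary_of_mem_capacityRegion T μ hT hw
    have hw0 := nonneg_of_mem_capacityRegion hw
    rcases hρ.eq_or_lt with h0 | h0
    · have hl0 : lam = 0 := by rw [hlam, ← h0, zero_smul]
      refine ⟨fun _ => ?_, ⟨p, hlam ▸ hp.smul T μ hρ⟩, fun _ q _ => ?_⟩ <;>
      · subst hl0
        rw [← h0, zero_div]
        exact weightedBacklogBound_zero S
    · refine ⟨fun hα => S.weightedBacklogBound_maxWeight hT h0 hρ1 hw0 hlam hp hα,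
        ⟨p, hlam ▸ hp.smul T μ hρ⟩, fun hα q hq => ?_⟩
      -- Cancelling `ρ > 0` turns any policy for `ρ • w` at level `ρ` into one for `w` at level 1.
      refine S.weightedBacklogBound_maxWeight1 hT h0 hρ1 hlam ⟨hq.1, hq.2.1, fun m => ?_⟩ hα
      have := hq.2.2 m
      rw [hlam, Pi.smul_apply, smul_eq_mul] at this
      rw [one_mul]
      exact le_of_mul_le_mul_left this h0
  · intro Ω _ P _ lam A α hS
    obtain ⟨ℱ, S⟩ := hS.exists_frameSystem (μ := μ) hKT hKμ
    exact ⟨S.boundGivenBacklog, S.boundGivenHistory⟩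
  · intro lam₀ h₀
    obtain ⟨p, hp⟩ := exists_stationary_of_mem_capacityRegion T μ hT h₀
    have hw0 := nonneg_of_mem_capacityRegion h₀
    obtain ⟨c, hc, hcw⟩ := exists_pos_le_of_ne_zero hw0
    refine ⟨M * (K : ℝ) ^ 2 / c, ?_⟩
    intro Ω _ P _ A α ρ _ hρ1 hS hα
    obtain ⟨ℱ, S⟩ := hS.exists_frameSystem (μ := μ) hKT hKμ
    exact S.totalBacklogLE_maxWeight hT hρ1 hc hw0 hcw rfl hp hα
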